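/- **Setting.** Let $\mathcal L:\mathbb R^d\to\mathbb R$ be differentiable, $L$-smooth and $\mu$-strongly convex with $\mu>0$, i.e. for all $\theta,\theta'\in\mathbb R^d$ $$\tfrac{\mu}{2}\|\theta-\theta'\|^2\le \mathcal L(\theta')-\mathcal L(\theta)-\langle\nabla\mathcal L(\theta),\theta'-\theta\rangle\le \tfrac L2\|\theta-\theta'\|^2 ,$$ and let $\theta^\star$ be its minimizer. Let $0\le\eta<1/2$, and let $\mathcal D_{\mathcal I}(\theta)$ and $\mathcal D_{\mathcal O}(\theta)$ be probability laws on $\mathbb R^d$ depending measurably on $\theta$ ($\mathcal D_{\mathcal O}$ is otherwise arbitrary). For $\widetilde G(\theta)\sim\mathcal D_{\mathcal I}(\theta)$ write $\varepsilon_\theta=\widetilde G(\theta)-\nabla\mathcal L(\theta)$, and assume: 1. $\mathbb E[\varepsilon_\theta]=0$, and $\varepsilon_\theta$ has law $\delta\nu_{\theta,1}+(1-\delta)\nu_{\theta,2}$ where $\delta\in(0,1]$ does not depend on $\theta$, $\nu_{\theta,1},\nu_{\theta,2}$ are probability measures, and $\nu_{\theta,1}$ has a Lebesgue density $h_\theta$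 with $\inf_{\|\omega\|\le R}h_\theta(\omega)>\varkappa(R)>0$ for all $R>0$, with $\varkappa$ independent of $\theta$. 2. For some $q\in(1,2)$ and $A_q,B_q>0$, $\ \mathbb E[\|\varepsilon_\theta\|^q]^{1/q}\le A_q\|\theta-\theta^\star\|+B_q$ for all $\theta$. 3. With $p=1-\eta$ and $\tau_\theta=Q_p(\|\widetilde G(\theta)\|)=\inf\{x:\mathbb P(\|\widetilde G(\theta)\|\le x)\ge p\}$ the clipping threshold, $\inf_{\|\theta\|\le R}\tau_\theta>0$ for every $R>0$. Quantile-clipped SGD (QC-SGD) with step size $\beta>0$ and quantile $p$ is the Markov chain $$\theta_{t+1}=\theta_t-\alpha_{\theta_t}\beta\,G_t,\qquad \alpha_{\theta_t}=\min\Big(1,\frac{\tau_{\theta_t}}{\|G_t\|}\Big),$$ where, given the past, $G_t$ has law $\eta\,\mathcal D_{\mathcal O}(\theta_t)+(1-\eta)\,\mathcal D_{\mathcal I}(\theta_t)$. Let $P_{\beta,p}$ be its transition kernel. **Statement.** Assume that $$\kappa':=(1-\eta)p\mu-q\eta L-2q\eta^{1-1/q}A_q>0,\qquad 0<\beta\le\frac{\eta}{\kappa'}\wedge\Big(\frac{\kappa'}{86(L+A_q)^q}\Big)^{\frac1{q-1}}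 .$$ Then $P_{\beta,1-\eta}$ has a unique invariant probability measure $\pi_{\beta,1-\eta}$, and the chain converges to it geometrically: for any initial $\theta_0\in\mathbb R^d$ there are $\rho\in[0,1)$ and $M<\infty$ such that for all $T\ge0$ $$\big\|\delta_{\theta_0}P_{\beta,1-\eta}^T-\pi_{\beta,1-\eta}\big\|_{\mathrm{TV}}\le M\rho^T\big(1+\|\theta_0-\theta^\star\|^2\big),$$ where $\|\nu_1-\nu_2\|_{\mathrm{TV}}=\sup_A|\nu_1(A)-\nu_2(A)|$ over Borel sets $A$. In addition, for $\theta\sim\pi_{\beta,1-\eta}$, the moment $\mathbb E\|\theta-\theta^\star\|^q$ is finite and $$\mathbb E\|\theta-\theta^\star\|^q\le128\Big(\frac{\eta^{1-1/q}B_q}{\kappa'}\Big)^q .$$ -/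

import Mathlib

open MeasureTheory ProbabilityTheory

namespace QCSGD

/-- The parameter space `ℝ^d` with its Euclidean norm. -/
abbrev E (d : ℕ) : Type := EuclideanSpace ℝ (Fin d)

section Objective

variable {d : ℕ}

/-- `f` is differentiable and `L`-Lipschitz-smooth: it lies below its tangent parabolas of
curvature `L`. -/
def LipschitzSmooth (f : E d → ℝ) (L : ℝ) : Prop :=
  Differentiable ℝ f ∧
    ∀ x y : E d, f y ≤ f x + inner ℝ (gradient f x) (y - x) + L / 2 * ‖x - y‖ ^ 2

/-- `f` is `μ`-strongly convex (with `μ > 0`), in its first-order form. -/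
def StronglyConvex (f : E d → ℝ) (μ : ℝ) : Prop :=
  0 < μ ∧ ∀ x y : E d, f x + inner ℝ (gradient f x) (y - x) + μ / 2 * ‖x - y‖ ^ 2 ≤ f y

end Objective

section Noise

variable {d : ℕ}

/-- The law `DI θ` of the uncorrupted gradient sample at `θ` is that of `∇f(θ) + ε_θ`, where
`ε_θ` is centered and has law `δ ν₁(θ) + (1 - δ) ν₂(θ)`, with `ν₁(θ)` having a Lebesgue density
`h θ` that is bounded below on every ball by a positive constant not depending on `θ`. -/
def DiffuseCenteredNoise (f : E d → ℝ) (DI : Kernel (E d) (E d)) : Prop :=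
  (∀ θ, Integrable (fun g => g - gradient f θ) (DI θ) ∧ ∫ g, (g - gradient f θ) ∂(DI θ) = 0) ∧
  ∃ (δ : ℝ) (ν₁ ν₂ : E d → Measure (E d)) (h : E d → E d → ENNReal) (c : ℝ → ℝ),
    0 < δ ∧ δ ≤ 1 ∧
    (∀ θ, IsProbabilityMeasure (ν₁ θ) ∧ IsProbabilityMeasure (ν₂ θ)) ∧
    (∀ θ, (DI θ).map (fun g => g - gradient f θ) =
      ENNReal.ofReal δ • ν₁ θ + ENNReal.ofReal (1 - δ) • ν₂ θ) ∧
    (∀ θ, Measurable (h θ) ∧ ν₁ θ = volume.withDensity (h θ)) ∧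
    ∀ R : ℝ, 0 < R → 0 < c R ∧
      ∀ θ, ENNReal.ofReal (c R) < ⨅ ω ∈ Metric.closedBall (0 : E d) R, h θ ω

/-- The `L_q` bound on the gradient error:
`E[‖ε_θ‖^q]^{1/q} ≤ A ‖θ - θs‖ + B` for every `θ`, with `A, B > 0`. -/
def GradientErrorMoment (f : E d → ℝ) (DI : Kernel (E d) (E d)) (θs : E d) (q A B : ℝ) : Prop :=
  0 < A ∧ 0 < B ∧
    ∀ θ, eLpNorm (fun g => g - gradient f θ) (ENNReal.ofReal q) (DI θ) ≤
      ENNReal.ofReal (A * ‖θ - θs‖ + B)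

end Noise

section Chain

variable {d : ℕ}

/-- The `p`-th quantile of a law on `ℝ`. -/
noncomputable def quantile (ν : Measure ℝ) (p : ℝ) : ℝ :=
  sInf {x : ℝ | p ≤ ν.real (Set.Iic x)}

/-- The clipping threshold `τ_θ`: the `p`-th quantile of the norm of an uncorrupted gradient
sample at `θ`. -/
noncomputable def threshold (DI : Kernel (E d) (E d)) (p : ℝ) (θ : E d) : ℝ :=
  quantile ((DI θ).map (fun g => ‖g‖)) p

/-- The law of the observed, `η`-corrupted gradient at `θ`, that is of `U Ǧ + (1 - U) G̃` with
`U` Bernoulli of parameter `η` independent of `Ǧ ∼ DO θ` and `G̃ ∼ DI θ`. -/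
noncomputable def corruptedGradient (η : ℝ) (DO DI : Kernel (E d) (E d)) :
    Kernel (E d) (E d) where
  toFun θ := ENNReal.ofReal η • DO θ + ENNReal.ofReal (1 - η) • DI θ
  measurable' := by
    refine Measure.measurable_of_measurable_coe _ fun s hs => ?_
    simp only [Measure.coe_add, Measure.coe_smul, Pi.add_apply, Pi.smul_apply, smul_eq_mul]
    exact ((DO.measurable_coe hs).const_mul _).add ((DI.measurable_coe hs).const_mul _)

/-- One clipped step from `θ` with step size `β`, threshold `τ` and gradient sample `g`.
(When `g = 0` the value of the clipping factor does not matter.) -/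
noncomputable def clippedStep (β τ : ℝ) (θ g : E d) : E d :=
  θ - (min 1 (τ / ‖g‖) * β) • g

lemma measurable_threshold (DI : Kernel (E d) (E d)) [IsMarkovKernel DI] (p : ℝ) :
    Measurable (threshold DI p) := by
  have hS : ∀ x : ℝ, MeasurableSet {θ | p ≤ ((DI θ).map (fun g => ‖g‖)).real (Set.Iic x)} := by
    intro x
    have : (fun θ => ((DI θ).map (fun g => ‖g‖)).real (Set.Iic x)) =
        fun θ => (DI θ ((fun g : E d => ‖g‖) ⁻¹' Set.Iic x)).toReal := by
      ext θ
      rw [Measure.real, Measure.map_apply measurable_norm measurableSet_Iic]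
    have hm : Measurable (fun θ => ((DI θ).map (fun g => ‖g‖)).real (Set.Iic x)) := by
      rw [this]
      exact (DI.measurable_coe (measurable_norm measurableSet_Iic)).ennreal_toReal
    exact measurableSet_le measurable_const hm
  rcases le_or_gt p 0 with hp | hp
  · have : threshold DI p = fun _ => sInf (Set.univ : Set ℝ) := by
      ext θ
      unfold threshold quantile
      congr 1
      ext x
      simpa using hp.trans measureReal_nonneg
    rw [this]
    exact measurable_const
  have hmono : ∀ θ (x y : ℝ), x ≤ y → p ≤ ((DI θ).map (fun g => ‖g‖)).real (Set.Iic x) →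
      p ≤ ((DI θ).map (fun g => ‖g‖)).real (Set.Iic y) := by
    intro θ x y hxy hx
    have : IsProbabilityMeasure ((DI θ).map (fun g => ‖g‖)) :=
      Measure.isProbabilityMeasure_map measurable_norm.aemeasurable
    exact hx.trans (measureReal_mono (Set.Iic_subset_Iic.2 hxy))
  have hbdd : ∀ θ, BddBelow {x : ℝ | p ≤ ((DI θ).map (fun g => ‖g‖)).real (Set.Iic x)} := by
    intro θ
    refine ⟨0, fun x hx => ?_⟩
    by_contra hx0
    have he : (fun g : E d => ‖g‖) ⁻¹' Set.Iic x = ∅ := by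
      ext g
      simp only [Set.mem_preimage, Set.mem_Iic, Set.mem_empty_iff_false, iff_false, not_le]
      exact lt_of_lt_of_le (not_le.1 hx0) (norm_nonneg g)
    have : ((DI θ).map (fun g => ‖g‖)).real (Set.Iic x) = 0 := by
      rw [Measure.real, Measure.map_apply measurable_norm measurableSet_Iic, he]
      simp
    have hx' : p ≤ ((DI θ).map (fun g => ‖g‖)).real (Set.Iic x) := hx
    linarith
  refine measurable_of_Iio fun a => ?_
  have hset : threshold DI p ⁻¹' Set.Iio a =
      (⋃ r : ℚ, {θ | (r : ℝ) < a ∧ p ≤ ((DI θ).map (fun g => ‖g‖)).real (Set.Iic (r : ℝ))}) ∪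
      (⋂ n : ℕ, {θ | 0 < a ∧ ¬ p ≤ ((DI θ).map (fun g => ‖g‖)).real (Set.Iic (n : ℝ))}) := by
    ext θ
    simp only [Set.mem_preimage, Set.mem_Iio, Set.mem_union, Set.mem_iUnion, Set.mem_iInter,
      Set.mem_ofPred_eq]
    constructor
    · intro h
      rcases Set.eq_empty_or_nonempty
        {x : ℝ | p ≤ ((DI θ).map (fun g => ‖g‖)).real (Set.Iic x)} with hem | hne
      · right
        intro n
        unfold threshold quantile at h
        rw [hem, Real.sInf_empty] at h
        exact ⟨h, fun hn => (Set.eq_empty_iff_forall_notMem.1 hem n) hn⟩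
      · left
        obtain ⟨x, hx, hxa⟩ := exists_lt_of_csInf_lt hne h
        obtain ⟨r, hr1, hr2⟩ := exists_rat_btwn hxa
        exact ⟨r, hr2, hmono θ x r hr1.le hx⟩
    · rintro (⟨r, hra, hr⟩ | h)
      · exact (csInf_le (hbdd θ) hr).trans_lt hra
      · have hem : {x : ℝ | p ≤ ((DI θ).map (fun g => ‖g‖)).real (Set.Iic x)} = ∅ := by
          refine Set.eq_empty_iff_forall_notMem.2 fun x hx => ?_
          obtain ⟨n, hn⟩ := exists_nat_ge x
          exact (h n).2 (hmono θ x n hn hx)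
        unfold threshold quantile
        rw [hem, Real.sInf_empty]
        exact (h 0).1
  rw [hset]
  refine MeasurableSet.union (MeasurableSet.iUnion fun r => ?_) (MeasurableSet.iInter fun n => ?_)
  · exact (MeasurableSet.const _).inter (hS r)
  · exact (MeasurableSet.const _).inter (hS n).compl

lemma measurable_step (DI : Kernel (E d) (E d)) [IsMarkovKernel DI] (p β : ℝ) :
    Measurable (fun x : E d × E d => clippedStep β (threshold DI p x.1) x.1 x.2) := by
  unfold clippedStep
  have h : Measurable (fun x : E d × E d => threshold DI p x.1) :=
    (measurable_threshold DI p).comp measurable_fst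
  have h2 : Measurable (fun x : E d × E d => min 1 (threshold DI p x.1 / ‖x.2‖) * β) :=
    (measurable_const.min (h.div measurable_snd.norm)).mul_const β
  exact measurable_fst.sub (h2.smul measurable_snd)

/-- The transition kernel `P_{β,p}` of quantile-clipped SGD: from `θ`, draw an `η`-corrupted
gradient sample `g` and move to `θ - α β g`, `α = min(1, τ_θ / ‖g‖)`. -/
noncomputable def transition (η : ℝ) (DO DI : Kernel (E d) (E d)) [IsMarkovKernel DO]
    [IsMarkovKernel DI] (β p : ℝ) : Kernel (E d) (E d) where
  toFun θ := (corruptedGradient η DO DI θ).map (clippedStep β (threshold DI p θ) θ)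
  measurable' := by
    have hfin : IsFiniteKernel (corruptedGradient η DO DI) := by
      refine ⟨⟨ENNReal.ofReal η + ENNReal.ofReal (1 - η), by simp, fun θ => ?_⟩⟩
      change (ENNReal.ofReal η • DO θ + ENNReal.ofReal (1 - η) • DI θ) Set.univ ≤ _
      simp
    refine Measure.measurable_of_measurable_coe _ fun s hs => ?_
    have hstep := measurable_step DI p β
    have h := Kernel.measurable_kernel_prodMk_left (κ := corruptedGradient η DO DI) (hstep hs)
    convert h using 2 with θ
    exact Measure.map_apply (hstep.comp measurable_prodMk_left) hs

/-- The law of the `T`-th iterate of the chain with transition kernel `P` and initial law `ν`,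
i.e. `ν P^T`, where `ν P = ∫ P(θ, ·) ν(dθ)`. -/
noncomputable def lawAt (P : Kernel (E d) (E d)) (ν : Measure (E d)) (T : ℕ) : Measure (E d) :=
  (fun m : Measure (E d) => m.bind P)^[T] ν

/-- The total variation distance `sup_A |ν₁(A) - ν₂(A)|` of two probability measures. -/
noncomputable def tvDist (ν₁ ν₂ : Measure (E d)) : ℝ :=
  ⨆ A : {A : Set (E d) // MeasurableSet A}, |ν₁.real A - ν₂.real A|

end Chain

end QCSGD

namespace QCSGD

/-! ### Oscillation contraction and geometric mixing from drift and minorization -/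

section Harris

open Filter Topology

variable {α : Type*} [MeasurableSpace α]

/-! The theorem is Harris' ergodic theorem applied with the Lyapunov function `V θ = ‖θ - θs‖ ^ q`.
Two facts about the chain are needed: a geometric drift of `V`, and a minorization of some iterate
on every ball around `θs`.

Drift (`lintegral_transition_le`). For `1 < q < 2` the function `‖·‖ ^ q` has a first-order
expansion with remainder `6 ‖y‖ ^ q` (`norm_sub_rpow_le`), so only `q`-th moments are required. An
outlier is clipped, hence displaces the iterate by at most `β τ`, and Markov's inequality gives `τ ≤
‖G‖ + η ^ (-1/q) σ` with `G` the gradient and `σ = A ‖θ - θs‖ + B`; weighted by its probability `η`,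
this costs order `η ^ (1 - 1/q) σ`. Clipping an inlier biases it only on an event of probability at
most `η`, and Hölder's inequality bounds that bias by `η ^ (1 - 1/q) σ` again
(`integral_inner_clip_ge`), while strong convexity supplies a contraction of size `p μ`. The two
costs explain the term `2 q η ^ (1 - 1/q) A` in `κ'`. The step size constraints absorb the
remainders, leaving contraction factor `1 - (62/86) β κ'` (`drift_bound_le`).

Minorization (`exists_pow_minorant_transition`). Samples shorter than the threshold are not clipped,
and the diffuse part of the inlier noise gives them a density bounded below. Hence one step charges
a ball of fixed radius about its starting point, uniformly over bounded sets, whatever the outliers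
do. Chaining such balls reaches a neighbourhood of `θs`.

Harris' theorem is proved by the Hairer–Mattingly argument: some iterate contracts oscillations
weighted by `1 + b V`, so the laws of the iterates are Cauchy uniformly over measurable sets. Their
setwise limit is the invariant law, and Fatou's lemma transfers the drift bound to its `q`-th
moment. -/

instance isMarkovKernel_pow (P : Kernel α α) [IsMarkovKernel P] (n : ℕ) :
    IsMarkovKernel (P ^ n) := by
  induction n with
  | zero => rw [pow_zero]; exact inferInstanceAs (IsMarkovKernel Kernel.id)
  | succ n ih => rw [pow_succ]; exact inferInstanceAs (IsMarkovKernel ((P ^ n) ∘ₖ P))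

/-- The shared part `ν` cancels in the difference, and `ψ` is replaced by `±w` only on the
remainders `μ₁ - ν` and `μ₂ - ν`. The subtraction of measures is avoided by using that `w - ψ` and
`w + ψ` are nonnegative. -/
lemma integral_sub_integral_le_of_common_minorant {μ₁ μ₂ ν : Measure α} (h₁ : ν ≤ μ₁)
    (h₂ : ν ≤ μ₂) {ψ w : α → ℝ} (hψ₁ : Integrable ψ μ₁) (hψ₂ : Integrable ψ μ₂)
    (hw₁ : Integrable w μ₁) (hw₂ : Integrable w μ₂) (hψw : ∀ x, |ψ x| ≤ w x) :
    ∫ x, ψ x ∂μ₁ - ∫ x, ψ x ∂μ₂ ≤ ∫ x, w x ∂μ₁ + ∫ x, w x ∂μ₂ - 2 * ∫ x, w x ∂ν := by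
  have hψν := hψ₁.mono_measure h₁
  have hwν := hw₁.mono_measure h₁
  have e₁ : ∫ x, (w x - ψ x) ∂ν ≤ ∫ x, (w x - ψ x) ∂μ₁ :=
    integral_mono_measure h₁ (Eventually.of_forall fun x => by
      simpa using (le_abs_self _).trans (hψw x)) (hw₁.sub hψ₁)
  have e₂ : ∫ x, (w x + ψ x) ∂ν ≤ ∫ x, (w x + ψ x) ∂μ₂ :=
    integral_mono_measure h₂ (Eventually.of_forall fun x => by
      have := neg_abs_le (ψ x)
      have := hψw x
      simp only [Pi.zero_apply]
      linarith) (hw₂.add hψ₂)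
  rw [integral_sub hwν hψν, integral_sub hw₁ hψ₁] at e₁
  rw [integral_add hwν hψν, integral_add hw₂ hψ₂] at e₂
  linarith

/-- The oscillation bound says that every lower bound `φ x - s (1 + b V x)` lies below every upper
bound `φ y + s (1 + b V y)`; the supremum of the former separates them. This recentring turns a
two-point bound into a weighted sup norm. -/
lemma exists_forall_abs_sub_le_of_oscillation {β : Type*} {φ V : β → ℝ} {s b : ℝ}
    (h : ∀ x y, |φ x - φ y| ≤ s * (2 + b * V x + b * V y)) :
    ∃ c, ∀ x, |φ x - c| ≤ s * (1 + b * V x) := by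
  rcases isEmpty_or_nonempty β with hα | hα
  · exact ⟨0, fun x => hα.elim x⟩
  have key : ∀ x y, φ x - s * (1 + b * V x) ≤ φ y + s * (1 + b * V y) := fun x y => by
    have := (le_abs_self _).trans (h x y)
    nlinarith
  have hbdd : BddAbove (Set.range fun x => φ x - s * (1 + b * V x)) :=
    ⟨_, by rintro _ ⟨x, rfl⟩; exact key x hα.some⟩
  refine ⟨⨆ x, (φ x - s * (1 + b * V x)), fun x => abs_le.2 ⟨?_, ?_⟩⟩
  · linarith [ciSup_le fun y => key y x]
  · linarith [le_ciSup hbdd x]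

/-- **Hairer–Mattingly contraction**: a Markov kernel with a drift condition and a minorization on
a large sublevel set contracts weighted oscillations. -/
theorem exists_weighted_oscillation_contraction (Q : Kernel α α) [IsMarkovKernel Q] {V : α → ℝ}
    (hV : ∀ x, 0 ≤ V x) {γ K R : ℝ} (hγ1 : γ < 1) (hK : 0 ≤ K)
    (hVi : ∀ x, Integrable V (Q x)) (hdrift : ∀ x, ∫ y, V y ∂(Q x) ≤ γ * V x + K)
    (hR : 2 * K < (1 - γ) * R) (ν : Measure α) (hν : 0 < ν.real Set.univ)
    (hminor : ∀ x, V x ≤ R → ν ≤ Q x) :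
    ∃ b a : ℝ, 0 < b ∧ 0 < a ∧ a < 1 ∧ ∀ (φ : α → ℝ) (s C : ℝ), Measurable φ →
      (∀ x, |φ x| ≤ C) → 0 ≤ s → (∀ x y, |φ x - φ y| ≤ s * (2 + b * V x + b * V y)) →
      ∀ x y, |∫ z, φ z ∂(Q x) - ∫ z, φ z ∂(Q y)| ≤ a * s * (2 + b * V x + b * V y) := by
  set ε := ν.real Set.univ with hε
  -- Small enough that the drift constant costs `2 b K ≤ ε`, half of the gain `2 ε` from the common
  -- minorant.
  set b := ε / (2 * (K + 1)) with hb
  have hb0 : 0 < b := by positivity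
  have hbK : 2 * b * K ≤ ε := by
    rw [hb, mul_div_assoc', div_mul_eq_mul_div, div_le_iff₀ (by positivity)]
    nlinarith
  have hR0 : 0 < R := by
    by_contra hcon
    nlinarith [mul_nonneg (sub_nonneg.2 hγ1.le) (neg_nonneg.2 (not_lt.1 hcon))]
  -- The contraction ratio obtained from drift alone when `V x + V y = R`; it is below `1` because
  -- `2 K < (1 - γ) R`. Any excess of `V x + V y` over `R` contracts by `γ ≤ a₁`.
  set a₁ := (2 + b * γ * R + 2 * b * K) / (2 + b * R) with ha₁
  have hden : 0 < 2 + b * R := by positivity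
  have ha₁1 : a₁ < 1 := by
    rw [ha₁, div_lt_one hden]
    nlinarith
  have ha₁γ : γ ≤ a₁ := by
    rw [ha₁, le_div_iff₀ hden]
    nlinarith [mul_nonneg hb0.le hK]
  have ha₁e : 2 + b * γ * R + 2 * b * K = a₁ * (2 + b * R) := by
    rw [ha₁, div_mul_cancel₀ _ hden.ne']
  -- `a₁` serves pairs far out, `1 - ε / 2` pairs in the sublevel set, and `1 / 2` only keeps `a`
  -- positive.
  set a := max a₁ (max (1 - ε / 2) (1 / 2)) with ha
  have haa₁ : a₁ ≤ a := le_max_left _ _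
  have haε : 1 - ε / 2 ≤ a := (le_max_left _ _).trans (le_max_right _ _)
  have hah : 1 / 2 ≤ a := (le_max_right _ _).trans (le_max_right _ _)
  refine ⟨b, a, hb0, by linarith, max_lt ha₁1 (max_lt (by linarith) (by norm_num)), ?_⟩
  intro φ s C hφ hφC hs hosc
  obtain ⟨c, hc⟩ := exists_forall_abs_sub_le_of_oscillation hosc
  have hφi : ∀ x, Integrable φ (Q x) := fun x =>
    Integrable.of_bound hφ.aestronglyMeasurable C (Eventually.of_forall hφC)
  have hwi : ∀ x, Integrable (fun z => s * (1 + b * V z)) (Q x) := fun x =>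
    ((integrable_const _).add ((hVi x).const_mul b)).const_mul s
  have hw : ∀ x, ∫ z, s * (1 + b * V z) ∂(Q x) ≤ s * (1 + b * (γ * V x + K)) := fun x => by
    rw [integral_const_mul, integral_add (integrable_const _) ((hVi x).const_mul b),
      integral_const_mul]
    simp only [integral_const, probReal_univ, smul_eq_mul, one_mul]
    gcongr
    exact hdrift x
  have hsub : ∀ x, ∫ z, (φ z - c) ∂(Q x) = ∫ z, φ z ∂(Q x) - c := fun x => by
    rw [integral_sub (hφi x) (integrable_const _)]
    simp
  have one_sided : ∀ x y, ∫ z, φ z ∂(Q x) - ∫ z, φ z ∂(Q y)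
      ≤ a * s * (2 + b * V x + b * V y) := by
    intro x y
    have hbound : ∀ ν' : Measure α, ν' ≤ Q x → ν' ≤ Q y →
        ∫ z, φ z ∂(Q x) - ∫ z, φ z ∂(Q y) ≤ s * (1 + b * (γ * V x + K)) +
          s * (1 + b * (γ * V y + K)) - 2 * ∫ z, s * (1 + b * V z) ∂ν' := by
      intro ν' h₁ h₂
      have := integral_sub_integral_le_of_common_minorant h₁ h₂
        ((hφi x).sub (integrable_const c)) ((hφi y).sub (integrable_const c)) (hwi x) (hwi y) hc
      simp only [Pi.sub_apply] at this
      rw [hsub, hsub] at this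
      linarith [hw x, hw y]
    have hx := hV x
    have hy := hV y
    by_cases hxy : V x ≤ R ∧ V y ≤ R
    · have h := hbound ν (hminor x hxy.1) (hminor y hxy.2)
      have hfin : IsFiniteMeasure ν := isFiniteMeasure_of_le (Q x) (hminor x hxy.1)
      have hνw : s * ε ≤ ∫ z, s * (1 + b * V z) ∂ν := by
        have : ∫ _z, s ∂ν = s * ε := by simp [mul_comm, hε]
        rw [← this]
        refine integral_mono (integrable_const _)
          ((hwi x).mono_measure (hminor x hxy.1)) fun z => ?_
        have := mul_nonneg hs (mul_nonneg hb0.le (hV z))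
        simp only
        linarith
      have h2 : 2 + b * γ * (V x + V y) + 2 * b * K - 2 * ε ≤ a * (2 + b * V x + b * V y) := by
        have : γ * (b * (V x + V y)) ≤ a * (b * (V x + V y)) :=
          mul_le_mul_of_nonneg_right (ha₁γ.trans haa₁) (by positivity)
        nlinarith
      have := mul_le_mul_of_nonneg_left h2 hs
      nlinarith
    -- Outside the sublevel set no minorant is available, and the zero measure leaves the pure drift
    -- estimate.
    · have h := hbound 0 (Measure.zero_le _) (Measure.zero_le _)
      have hS : R ≤ V x + V y := by
        by_contra hcon
        exact hxy ⟨by linarith, by linarith⟩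
      have h2 : 2 + b * γ * (V x + V y) + 2 * b * K ≤ a * (2 + b * V x + b * V y) := by
        have e1 : γ * (b * (V x + V y - R)) ≤ a₁ * (b * (V x + V y - R)) :=
          mul_le_mul_of_nonneg_right ha₁γ (mul_nonneg hb0.le (by linarith))
        have e2 : a₁ * (2 + b * V x + b * V y) ≤ a * (2 + b * V x + b * V y) :=
          mul_le_mul_of_nonneg_right haa₁ (by positivity)
        nlinarith
      have := mul_le_mul_of_nonneg_left h2 hs
      rw [integral_zero_measure] at h
      nlinarith
  intro x y
  refine abs_le.2 ⟨?_, one_sided x y⟩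
  have := one_sided y x
  linarith

/-- The additive constants form a geometric series with sum at most `K / (1 - γ)`, so a single level
works for all iterates. Lower integrals avoid any prior integrability. -/
lemma lintegral_pow_le_of_drift (P : Kernel α α) [IsMarkovKernel P] {V : α → ℝ}
    (hVm : Measurable V) (hV : ∀ x, 0 ≤ V x) {γ K : ℝ} (hγ0 : 0 ≤ γ) (hγ1 : γ < 1) (hK : 0 ≤ K)
    (hdrift : ∀ x, ∫⁻ y, ENNReal.ofReal (V y) ∂(P x) ≤ ENNReal.ofReal (γ * V x + K))
    (n : ℕ) (x : α) :
    ∫⁻ y, ENNReal.ofReal (V y) ∂((P ^ n) x) ≤ ENNReal.ofReal (γ ^ n * V x + K / (1 - γ)) := by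
  have hK' : 0 ≤ K / (1 - γ) := div_nonneg hK (by linarith)
  induction n with
  | zero =>
    rw [pow_zero]
    change ∫⁻ y, ENNReal.ofReal (V y) ∂(Kernel.id x) ≤ _
    rw [Kernel.id_apply, lintegral_dirac' _ hVm.ennreal_ofReal]
    exact ENNReal.ofReal_le_ofReal (by simp [hK'])
  | succ n ih =>
    rw [pow_succ']
    change ∫⁻ y, ENNReal.ofReal (V y) ∂((P ∘ₖ (P ^ n)) x) ≤ _
    rw [Kernel.lintegral_comp _ _ _ hVm.ennreal_ofReal]
    calc ∫⁻ y, ∫⁻ z, ENNReal.ofReal (V z) ∂(P y) ∂((P ^ n) x)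
        ≤ ∫⁻ y, (ENNReal.ofReal γ * ENNReal.ofReal (V y) + ENNReal.ofReal K) ∂((P ^ n) x) := by
          refine lintegral_mono fun y => (hdrift y).trans_eq ?_
          rw [ENNReal.ofReal_add (mul_nonneg hγ0 (hV y)) hK, ENNReal.ofReal_mul hγ0]
      _ = ENNReal.ofReal γ * ∫⁻ y, ENNReal.ofReal (V y) ∂((P ^ n) x) + ENNReal.ofReal K := by
          rw [lintegral_add_right _ measurable_const,
            lintegral_const_mul _ hVm.ennreal_ofReal]
          simp
      _ ≤ ENNReal.ofReal γ * ENNReal.ofReal (γ ^ n * V x + K / (1 - γ)) + ENNReal.ofReal K := by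
          gcongr
      _ = ENNReal.ofReal (γ ^ (n + 1) * V x + K / (1 - γ)) := by
          have := hV x
          rw [← ENNReal.ofReal_mul hγ0, ← ENNReal.ofReal_add (by positivity) hK]
          congr 1
          have : 1 - γ ≠ 0 := by linarith
          field_simp
          ring

lemma integrable_and_integral_le_of_lintegral_le {μ : Measure α} {V : α → ℝ} (hVm : Measurable V)
    (hV : ∀ x, 0 ≤ V x) {c : ℝ} (hc : 0 ≤ c)
    (h : ∫⁻ y, ENNReal.ofReal (V y) ∂μ ≤ ENNReal.ofReal c) :
    Integrable V μ ∧ ∫ y, V y ∂μ ≤ c := by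
  refine ⟨⟨hVm.aestronglyMeasurable, ?_⟩, ?_⟩
  · rw [hasFiniteIntegral_iff_ofReal (Eventually.of_forall hV)]
    exact h.trans_lt ENNReal.ofReal_lt_top
  · rw [integral_eq_lintegral_of_nonneg_ae (Eventually.of_forall hV) hVm.aestronglyMeasurable]
    exact ENNReal.toReal_le_of_le_ofReal hc h

lemma pow_add_real_apply (P : Kernel α α) [IsMarkovKernel P] (m n : ℕ) (x : α) {A : Set α}
    (hA : MeasurableSet A) :
    ((P ^ (m + n)) x).real A = ∫ y, ((P ^ n) y).real A ∂((P ^ m) x) := by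
  rw [Measure.real, Kernel.pow_add_apply_eq_lintegral P m n x hA]
  exact (integral_toReal ((P ^ n).measurable_coe hA).aemeasurable
    (Eventually.of_forall fun y => measure_lt_top _ _)).symm

lemma measurable_kernel_real (Q : Kernel α α) {A : Set α} (hA : MeasurableSet A) :
    Measurable fun x => (Q x).real A :=
  (Q.measurable_coe hA).ennreal_toReal

lemma abs_measureReal_sub_le_one (μ ν : Measure α) [IsProbabilityMeasure μ]
    [IsProbabilityMeasure ν] (A : Set α) : |μ.real A - ν.real A| ≤ 1 :=
  abs_le.2 ⟨by linarith [measureReal_le_one (μ := ν) (s := A), measureReal_nonneg (μ := μ) (s := A)],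
    by linarith [measureReal_le_one (μ := μ) (s := A), measureReal_nonneg (μ := ν) (s := A)]⟩

/-- Geometric decay of weighted oscillations of the iterates of a Markov kernel. -/
theorem exists_geometric_oscillation_bound (P : Kernel α α) [IsMarkovKernel P] {V : α → ℝ}
    (hVm : Measurable V) (hV : ∀ x, 0 ≤ V x) {γ K : ℝ} (hγ0 : 0 ≤ γ) (hγ1 : γ < 1) (hK : 0 ≤ K)
    (hdrift : ∀ x, ∫⁻ y, ENNReal.ofReal (V y) ∂(P x) ≤ ENNReal.ofReal (γ * V x + K))
    (hminor : ∀ R : ℝ, ∃ m : ℕ, 0 < m ∧ ∃ ν : Measure α, 0 < ν.real Set.univ ∧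
      ∀ x, V x ≤ R → ν ≤ (P ^ m) x) :
    ∃ b C ρ : ℝ, 0 < b ∧ 0 < C ∧ 0 < ρ ∧ ρ < 1 ∧ ∀ (n : ℕ) (A : Set α), MeasurableSet A →
      ∀ x y, |((P ^ n) x).real A - ((P ^ n) y).real A| ≤ C * ρ ^ n * (2 + b * V x + b * V y) := by
  have hK' : 0 ≤ K / (1 - γ) := div_nonneg hK (by linarith)
  have h1γ : 0 < 1 - γ := by linarith
  -- The level must beat the drift constant of `P ^ m`, where `m` itself depends on `R`; the bound
  -- `K / (1 - γ)`, uniform in `m`, breaks the circle.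
  set R := (2 * (K / (1 - γ)) + 1) / (1 - γ) with hRdef
  have hR : 2 * (K / (1 - γ)) < (1 - γ) * R := by
    rw [hRdef, mul_div_cancel₀ _ h1γ.ne']
    linarith
  obtain ⟨m, hm, ν, hν, hmin⟩ := hminor R
  have hpow : ∀ x, Integrable V ((P ^ m) x) ∧ ∫ y, V y ∂((P ^ m) x) ≤ γ * V x + K / (1 - γ) := by
    intro x
    have hx := hV x
    have h := integrable_and_integral_le_of_lintegral_le hVm hV
      (by positivity) (lintegral_pow_le_of_drift P hVm hV hγ0 hγ1 hK hdrift m x)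
    refine ⟨h.1, h.2.trans ?_⟩
    gcongr
    exact pow_le_of_le_one hγ0 hγ1.le hm.ne'
  obtain ⟨b, a, hb, ha0, ha1, hcontr⟩ := exists_weighted_oscillation_contraction (P ^ m) hV hγ1
    hK' (fun x => (hpow x).1) (fun x => (hpow x).2) hR ν hν hmin
  have hblock : ∀ (A : Set α), MeasurableSet A → ∀ k j x y,
      |((P ^ (m * k + j)) x).real A - ((P ^ (m * k + j)) y).real A| ≤
        a ^ k * (2 + b * V x + b * V y) := by
    intro A hA k j
    induction k with
    | zero =>
      intro x y
      have := mul_nonneg hb.le (hV x)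
      have := mul_nonneg hb.le (hV y)
      have := abs_measureReal_sub_le_one ((P ^ (m * 0 + j)) x) ((P ^ (m * 0 + j)) y) A
      rw [pow_zero, one_mul]
      linarith
    | succ k ih =>
      intro x y
      rw [show m * (k + 1) + j = m + (m * k + j) by ring, pow_add_real_apply P m _ x hA,
        pow_add_real_apply P m _ y hA, pow_succ']
      refine hcontr _ (a ^ k) 1 (measurable_kernel_real _ hA) (fun z => ?_) (by positivity) ih x y
      rw [abs_of_nonneg measureReal_nonneg]
      exact measureReal_le_one
  set ρ := a ^ (1 / (m : ℝ)) with hρ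
  have hm' : (0 : ℝ) < m := by exact_mod_cast hm
  have hρ0 : 0 < ρ := Real.rpow_pos_of_pos ha0 _
  have hρ1 : ρ < 1 := Real.rpow_lt_one ha0.le ha1 (by positivity)
  have hρm : ρ ^ m = a := by
    rw [hρ, ← Real.rpow_natCast, ← Real.rpow_mul ha0.le, one_div_mul_cancel hm'.ne', Real.rpow_one]
  -- The factor `a⁻¹` pays for the incomplete block of `n % m < m` steps, on which no contraction is
  -- claimed.
  refine ⟨b, a⁻¹, ρ, hb, by positivity, hρ0, hρ1, fun n A hA x y => ?_⟩
  have h := hblock A hA (n / m) (n % m) x y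
  rw [Nat.div_add_mod] at h
  refine h.trans ?_
  have hx := hV x
  have hy := hV y
  gcongr
  have e : ρ ^ n = a ^ (n / m) * ρ ^ (n % m) := by
    conv_lhs => rw [← Nat.div_add_mod n m, pow_add, pow_mul, hρm]
  have e2 : a ≤ ρ ^ (n % m) := by
    rw [← hρm]
    exact pow_le_pow_of_le_one hρ0.le hρ1.le (Nat.mod_lt _ hm).le
  rw [e, ← div_eq_inv_mul, le_div_iff₀ ha0]
  gcongr

end Harris

/-! ### Setwise limits of measures and Harris' theorem -/

section SetwiseLimit

open Filter Topology

variable {α : Type*} [MeasurableSpace α]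

/-- A sequence of probability measures that is Cauchy uniformly on measurable sets converges
uniformly on measurable sets to a probability measure. -/
theorem exists_limit_of_uniform_cauchy (μ : ℕ → Measure α) [∀ n, IsProbabilityMeasure (μ n)]
    (ε : ℕ → ℝ) (hε : Tendsto ε atTop (𝓝 0))
    (h : ∀ (A : Set α), MeasurableSet A → ∀ n k, |(μ (n + k)).real A - (μ n).real A| ≤ ε n) :
    ∃ π : Measure α, IsProbabilityMeasure π ∧
      ∀ A, MeasurableSet A → ∀ n, |(μ n).real A - π.real A| ≤ ε n := by
  have hlim : ∀ A : Set α, ∃ l : ℝ, MeasurableSet A → Tendsto (fun n => (μ n).real A) atTop (𝓝 l) := by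
    intro A
    by_cases hA : MeasurableSet A
    · have hc : CauchySeq fun n => (μ n).real A := by
        refine cauchySeq_of_le_tendsto_0' ε (fun n m hnm => ?_) hε
        obtain ⟨k, rfl⟩ := Nat.exists_eq_add_of_le hnm
        rw [dist_comm, Real.dist_eq]
        exact h A hA n k
      obtain ⟨l, hl⟩ := cauchySeq_tendsto_of_complete hc
      exact ⟨l, fun _ => hl⟩
    · exact ⟨0, fun hA' => absurd hA' hA⟩
  choose l hl using hlim
  have hl0 : ∀ A, MeasurableSet A → 0 ≤ l A := fun A hA =>
    ge_of_tendsto' (hl A hA) fun n => measureReal_nonneg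
  have hle : ∀ A, MeasurableSet A → ∀ n, |(μ n).real A - l A| ≤ ε n := by
    intro A hA n
    rw [abs_sub_comm]
    have h1 : Tendsto (fun k => (μ (n + k)).real A) atTop (𝓝 (l A)) := by
      have := (tendsto_add_atTop_iff_nat n).2 (hl A hA)
      simpa only [add_comm] using this
    exact le_of_tendsto' (h1.sub_const _).abs fun k => h A hA n k
  have hadd : ∀ A B, MeasurableSet A → MeasurableSet B → Disjoint A B → l (A ∪ B) = l A + l B := by
    intro A B hA hB hAB
    refine tendsto_nhds_unique (hl _ (hA.union hB)) (((hl A hA).add (hl B hB)).congr fun n => ?_)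
    exact (measureReal_union hAB hB).symm
  have hempty : l ∅ = 0 := by
    refine tendsto_nhds_unique (hl ∅ MeasurableSet.empty) ?_
    simp
  have huniv : l Set.univ = 1 := by
    refine tendsto_nhds_unique (hl _ MeasurableSet.univ) ?_
    simp
  -- Continuity at `∅` is where uniformity over sets enters: a single `μ n` is within `e / 2` of `l`
  -- on all `A i` at once, and it is already continuous from above.
  have htail : ∀ A : ℕ → Set α, (∀ i, MeasurableSet (A i)) → Antitone A → (⋂ i, A i) = ∅ →
      Tendsto (fun i => l (A i)) atTop (𝓝 0) := by
    intro A hA hanti hinter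
    rw [Metric.tendsto_atTop]
    intro e he
    obtain ⟨n, hn⟩ := ((tendsto_order.1 hε).2 (e / 2) (by positivity)).exists
    have hμ : Tendsto (fun i => (μ n).real (A i)) atTop (𝓝 0) := by
      have := tendsto_measure_iInter_atTop (μ := μ n) (fun i => (hA i).nullMeasurableSet) hanti
        ⟨0, measure_ne_top _ _⟩
      rw [hinter, measure_empty] at this
      exact (ENNReal.tendsto_toReal ENNReal.zero_ne_top).comp this
    obtain ⟨N, hN⟩ := eventually_atTop.1 ((tendsto_order.1 hμ).2 (e / 2) (by positivity))
    refine ⟨N, fun i hi => ?_⟩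
    rw [Real.dist_eq, sub_zero, abs_of_nonneg (hl0 _ (hA i))]
    have := (abs_le.1 (hle _ (hA i) n)).1
    linarith [hN i hi]
  have hsum : ∀ A : ℕ → Set α, (∀ i, MeasurableSet (A i)) → Pairwise (Function.onFun Disjoint A) →
      HasSum (fun i => l (A i)) (l (⋃ i, A i)) := by
    intro A hA hdisj
    have hpart : ∀ n, l (⋃ i, A i) =
        (∑ i ∈ Finset.range n, l (A i)) + l (⋃ i, A (i + n)) := by
      intro n
      induction n with
      | zero => simp
      | succ n ih =>
        rw [ih, Finset.sum_range_succ, add_assoc]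
        congr 1
        have hU : (⋃ i, A (i + n)) = A n ∪ ⋃ i, A (i + (n + 1)) := by
          ext x
          simp only [Set.mem_iUnion, Set.mem_union]
          constructor
          · rintro ⟨i, hi⟩
            rcases i with _ | i
            · exact Or.inl (by simpa using hi)
            · exact Or.inr ⟨i, by rwa [show i + (n + 1) = i + 1 + n by ring]⟩
          · rintro (hx | ⟨i, hi⟩)
            · exact ⟨0, by simpa using hx⟩
            · exact ⟨i + 1, by rwa [show i + 1 + n = i + (n + 1) by ring]⟩
        rw [hU]
        refine hadd _ _ (hA n) (MeasurableSet.iUnion fun i => hA _) ?_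
        exact Set.disjoint_iUnion_right.2 fun i => hdisj (by omega)
    rw [hasSum_iff_tendsto_nat_of_nonneg fun i => hl0 _ (hA i)]
    have ht := htail (fun n => ⋃ i, A (i + n)) (fun n => MeasurableSet.iUnion fun i => hA _)
      (fun n m hnm => Set.iUnion_subset fun i => by
        refine Set.subset_iUnion_of_subset (i + (m - n)) ?_
        rw [show i + (m - n) + n = i + m by omega])
      (by
        refine Set.eq_empty_iff_forall_notMem.2 fun x hx => ?_
        rw [Set.mem_iInter] at hx
        obtain ⟨i, hi⟩ := Set.mem_iUnion.1 (hx 0)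
        obtain ⟨j, hj⟩ := Set.mem_iUnion.1 (hx (i + 1))
        exact Set.disjoint_left.1 (hdisj (show i + 0 ≠ j + (i + 1) by omega)) hi hj)
    have := ht.const_sub (l (⋃ i, A i))
    rw [sub_zero] at this
    refine this.congr fun n => ?_
    rw [hpart n]
    ring
  let π : Measure α := Measure.ofMeasurable (fun A _ => ENNReal.ofReal (l A)) (by simp [hempty])
    (fun A hA hdisj => by
      rw [← (hsum A hA hdisj).tsum_eq,
        ENNReal.ofReal_tsum_of_nonneg (fun i => hl0 _ (hA i)) (hsum A hA hdisj).summable])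
  have hπ : ∀ A, MeasurableSet A → π A = ENNReal.ofReal (l A) := fun A hA =>
    Measure.ofMeasurable_apply A hA
  refine ⟨π, ⟨by rw [hπ _ MeasurableSet.univ, huniv, ENNReal.ofReal_one]⟩, fun A hA n => ?_⟩
  rw [Measure.real.eq_1 π, hπ A hA, ENNReal.toReal_ofReal (hl0 A hA)]
  exact hle A hA n

/-- Fatou's lemma for setwise convergent measures. -/
lemma lintegral_le_liminf_of_tendsto_setwise {μ : ℕ → Measure α} {π : Measure α}
    (h : ∀ A, MeasurableSet A → Tendsto (fun n => μ n A) atTop (𝓝 (π A))) {φ : α → ℝ}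
    (hφ : Measurable φ) (hφ0 : ∀ x, 0 ≤ φ x) :
    ∫⁻ x, ENNReal.ofReal (φ x) ∂π ≤ liminf (fun n => ∫⁻ x, ENNReal.ofReal (φ x) ∂(μ n)) atTop := by
  -- The layer-cake formula turns setwise convergence into pointwise convergence of the tail
  -- functions, to which the usual Fatou lemma applies.
  have hlayer : ∀ m : Measure α, ∫⁻ x, ENNReal.ofReal (φ x) ∂m =
      ∫⁻ t in Set.Ioi (0 : ℝ), m {x | t < φ x} := fun m =>
    lintegral_eq_lintegral_meas_lt m (Eventually.of_forall hφ0) hφ.aemeasurable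
  simp_rw [hlayer]
  calc ∫⁻ t in Set.Ioi (0 : ℝ), π {x | t < φ x}
      = ∫⁻ t in Set.Ioi (0 : ℝ), liminf (fun n => μ n {x | t < φ x}) atTop := by
        refine lintegral_congr fun t => ?_
        exact ((h _ (measurableSet_lt measurable_const hφ)).liminf_eq).symm
    _ ≤ _ := lintegral_liminf_le fun n => Antitone.measurable fun s t hst =>
        measure_mono fun x (hx : t < φ x) => lt_of_le_of_lt hst hx

/-- **Harris' theorem**: a Markov kernel with a geometric drift condition, some iterate of which is
minorized on each sublevel set of the drift function, is geometrically ergodic. -/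
theorem harris_theorem [Nonempty α] (P : Kernel α α) [IsMarkovKernel P] {V : α → ℝ}
    (hVm : Measurable V) (hV : ∀ x, 0 ≤ V x) {γ K : ℝ} (hγ0 : 0 ≤ γ) (hγ1 : γ < 1) (hK : 0 ≤ K)
    (hdrift : ∀ x, ∫⁻ y, ENNReal.ofReal (V y) ∂(P x) ≤ ENNReal.ofReal (γ * V x + K))
    (hminor : ∀ R : ℝ, ∃ m : ℕ, 0 < m ∧ ∃ ν : Measure α, 0 < ν.real Set.univ ∧
      ∀ x, V x ≤ R → ν ≤ (P ^ m) x) :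
    ∃ π : Measure α, IsProbabilityMeasure π ∧ P.Invariant π ∧
      (∀ π' : Measure α, IsProbabilityMeasure π' → P.Invariant π' → π' = π) ∧
      (∃ ρ : ℝ, 0 ≤ ρ ∧ ρ < 1 ∧ ∀ x, ∃ M : ℝ, ∀ n A, MeasurableSet A →
        |((P ^ n) x).real A - π.real A| ≤ M * ρ ^ n) ∧
      ∀ x, ∫⁻ y, ENNReal.ofReal (V y) ∂π ≤ ENNReal.ofReal (V x + K / (1 - γ)) := by
  obtain ⟨b, C, ρ, hb, hC, hρ0, hρ1, hosc⟩ :=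
    exists_geometric_oscillation_bound P hVm hV hγ0 hγ1 hK hdrift hminor
  have hK' : 0 ≤ K / (1 - γ) := div_nonneg hK (by linarith)
  have hVk : ∀ x k, Integrable V ((P ^ k) x) ∧
      ∫ y, V y ∂((P ^ k) x) ≤ V x + K / (1 - γ) := by
    intro x k
    have hx := hV x
    have h := integrable_and_integral_le_of_lintegral_le hVm hV
      (by positivity) (lintegral_pow_le_of_drift P hVm hV hγ0 hγ1 hK hdrift k x)
    refine ⟨h.1, h.2.trans ?_⟩
    gcongr
    exact mul_le_of_le_one_left hx (pow_le_one₀ hγ0 hγ1.le)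
  let M : α → ℝ := fun x => C * (2 + b * V x + b * (V x + K / (1 - γ)))
  have hint : ∀ (Q : Kernel α α) [IsMarkovKernel Q] (m : Measure α) [IsProbabilityMeasure m]
      (A : Set α), MeasurableSet A → Integrable (fun y => (Q y).real A) m := fun Q _ m _ A hA =>
    Integrable.of_bound (measurable_kernel_real Q hA).aestronglyMeasurable 1
      (Eventually.of_forall fun y => by
        rw [Real.norm_eq_abs, abs_of_nonneg measureReal_nonneg]
        exact measureReal_le_one)
  have hcauchy : ∀ x, ∀ A : Set α, MeasurableSet A → ∀ n k,
      |((P ^ (n + k)) x).real A - ((P ^ n) x).real A| ≤ M x * ρ ^ n := by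
    intro x A hA n k
    -- Run the first `k` steps, then compare `n` further steps started at `y` and at `x`. The
    -- moments of `V` under `P ^ k` are bounded in `k`, so the estimate is uniform in `k` and `A`.
    have e : ((P ^ (n + k)) x).real A - ((P ^ n) x).real A =
        ∫ y, (((P ^ n) y).real A - ((P ^ n) x).real A) ∂((P ^ k) x) := by
      rw [add_comm n k, pow_add_real_apply P k n x hA,
        integral_sub (hint _ _ A hA) (integrable_const _)]
      simp
    have hwi : Integrable (fun y => C * ρ ^ n * (2 + b * V y + b * V x)) ((P ^ k) x) :=
      (((integrable_const _).add ((hVk x k).1.const_mul b)).add (integrable_const _)).const_mul _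
    rw [e]
    calc |∫ y, (((P ^ n) y).real A - ((P ^ n) x).real A) ∂((P ^ k) x)|
        ≤ ∫ y, |((P ^ n) y).real A - ((P ^ n) x).real A| ∂((P ^ k) x) := abs_integral_le_integral_abs
      _ ≤ ∫ y, C * ρ ^ n * (2 + b * V y + b * V x) ∂((P ^ k) x) :=
          integral_mono ((hint _ _ A hA).sub (integrable_const _)).abs hwi
            fun y => hosc n A hA y x
      _ = C * ρ ^ n * (2 + b * ∫ y, V y ∂((P ^ k) x) + b * V x) := by
          have h2 : Integrable (fun y => 2 + b * V y) ((P ^ k) x) :=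
            (integrable_const _).add ((hVk x k).1.const_mul b)
          rw [integral_const_mul, integral_add h2 (integrable_const _),
            integral_add (integrable_const _) ((hVk x k).1.const_mul b), integral_const_mul]
          simp
      _ ≤ C * ρ ^ n * (2 + b * (V x + K / (1 - γ)) + b * V x) := by
          have := (hVk x k).2
          gcongr
      _ = M x * ρ ^ n := by
          simp only [M]
          ring
  have hρlim : ∀ c : ℝ, Tendsto (fun n => c * ρ ^ n) atTop (𝓝 0) := fun c => by
    simpa using (tendsto_pow_atTop_nhds_zero_of_lt_one hρ0.le hρ1).const_mul c
  let x₀ : α := Classical.arbitrary α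
  obtain ⟨π, hπ, hπlim⟩ := exists_limit_of_uniform_cauchy (fun n => (P ^ n) x₀)
    (fun n => M x₀ * ρ ^ n) (hρlim _) (hcauchy x₀)
  have hreal : ∀ x A, MeasurableSet A →
      Tendsto (fun n => ((P ^ n) x).real A) atTop (𝓝 (π.real A)) := by
    intro x A hA
    rw [tendsto_iff_norm_sub_tendsto_zero]
    refine squeeze_zero (fun n => norm_nonneg _) (fun n => ?_)
      (hρlim (C * (2 + b * V x + b * V x₀) + M x₀))
    calc |((P ^ n) x).real A - π.real A|
        ≤ |((P ^ n) x).real A - ((P ^ n) x₀).real A| + |((P ^ n) x₀).real A - π.real A| :=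
          abs_sub_le _ _ _
      _ ≤ C * ρ ^ n * (2 + b * V x + b * V x₀) + M x₀ * ρ ^ n :=
          add_le_add (hosc n A hA x x₀) (hπlim A hA n)
      _ = _ := by ring
  have hset : ∀ x A, MeasurableSet A → Tendsto (fun n => (P ^ n) x A) atTop (𝓝 (π A)) := by
    intro x A hA
    have := ENNReal.tendsto_ofReal (hreal x A hA)
    simpa only [Measure.real, ENNReal.ofReal_toReal (measure_ne_top _ _)] using this
  refine ⟨π, hπ, ?_, ?_, ⟨ρ, hρ0.le, hρ1, fun x => ⟨M x, fun n A hA => ?_⟩⟩, fun x => ?_⟩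
  -- Fatou with the test function `P(·, A)` yields only an inequality, but two probability measures
  -- that are so ordered coincide.
  · have hle : π.bind P ≤ π := by
      refine Measure.le_iff.2 fun A hA => ?_
      rw [Measure.bind_apply hA P.aemeasurable]
      have hF := lintegral_le_liminf_of_tendsto_setwise (hset x₀) (measurable_kernel_real P hA)
        fun x => measureReal_nonneg
      simp only [Measure.real, ENNReal.ofReal_toReal (measure_ne_top _ _)] at hF
      refine hF.trans_eq ?_
      have h1 := (tendsto_add_atTop_iff_nat 1).2 (hset x₀ A hA)
      refine (Tendsto.liminf_eq (h1.congr fun n => ?_))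
      exact Kernel.pow_succ_apply_eq_lintegral P n x₀ hA
    have : IsProbabilityMeasure (π.bind P) := by
      constructor
      rw [Measure.bind_apply MeasurableSet.univ P.aemeasurable]
      simp
    exact Measure.eq_of_le_of_isProbabilityMeasure hle
  · intro π' hπ' hinv
    have hpow : ∀ n, (P ^ n).Invariant π' := by
      intro n
      induction n with
      | zero => exact Measure.id_comp
      | succ n ih =>
        rw [pow_succ]
        exact ih.comp hinv
    refine Measure.ext fun A hA => ?_
    -- Dominated convergence with bound `1` passes to the limit, so no moment of `π'` is needed.
    have hconst : ∀ n, ∫⁻ y, (P ^ n) y A ∂π' = π' A := fun n => by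
      rw [← Measure.bind_apply hA (P ^ n).aemeasurable, (hpow n).def]
    have hdct := tendsto_lintegral_of_dominated_convergence (μ := π') (fun _ => 1)
      (fun n => (P ^ n).measurable_coe hA) (fun n => Eventually.of_forall fun y => prob_le_one)
      (by simp) (Eventually.of_forall fun y => hset y A hA)
    simp only [hconst, lintegral_const, measure_univ, mul_one] at hdct
    exact tendsto_nhds_unique tendsto_const_nhds hdct
  · have h1 : Tendsto (fun k => ((P ^ (n + k)) x).real A) atTop (𝓝 (π.real A)) := by
      have := (tendsto_add_atTop_iff_nat n).2 (hreal x A hA)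
      simpa only [add_comm] using this
    rw [abs_sub_comm]
    exact le_of_tendsto' (h1.sub_const _).abs fun k => hcauchy x A hA n k
  · refine (lintegral_le_liminf_of_tendsto_setwise (hset x) hVm hV).trans ?_
    refine (liminf_le_liminf (Eventually.of_forall fun n =>
      (lintegral_pow_le_of_drift P hVm hV hγ0 hγ1 hK hdrift n x).trans
      (ENNReal.ofReal_le_ofReal (add_le_add_left
        (mul_le_of_le_one_left (hV x) (pow_le_one₀ hγ0 hγ1.le)) (K / (1 - γ)))))).trans_eq ?_
    exact liminf_const _

end SetwiseLimit

/-! ### Minorization of the iterates on balls -/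

section Minorization

variable {d : ℕ}

/-- A kernel that charges a neighbourhood of fixed size around each point of a ball, uniformly,
charges after sufficiently many steps the centre of the ball. -/
lemma exists_pow_minorant_of_local_minorant (P : Kernel (E d) (E d)) [IsMarkovKernel P]
    (θs : E d) {R r ε : ℝ} (hr : 0 < r) (hε : 0 < ε)
    (hlocal : ∀ θ, ‖θ - θs‖ ≤ R →
      ENNReal.ofReal ε • volume.restrict (Metric.closedBall θ r) ≤ P θ) (n : ℕ)
    (hn : (n + 1 : ℝ) * (r / 4) ≤ R) :
    ∃ e : ENNReal, 0 < e ∧ ∀ θ, ‖θ - θs‖ ≤ (n + 1 : ℝ) * (r / 4) →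
      e • volume.restrict (Metric.closedBall θs (r / 4)) ≤ (P ^ (n + 1)) θ := by
  induction n with
  | zero =>
    refine ⟨ENNReal.ofReal ε, by simpa using hε, fun θ hθ => ?_⟩
    simp only [Nat.cast_zero, zero_add, one_mul] at hθ hn
    rw [zero_add, pow_one]
    refine le_trans ?_ (hlocal θ (hθ.trans hn))
    gcongr
    refine Metric.closedBall_subset_closedBall' ?_
    rw [dist_comm, dist_eq_norm]
    linarith
  | succ n ih =>
    push_cast at hn ⊢
    obtain ⟨e, he, hmin⟩ := ih (by nlinarith)
    set v := volume (Metric.closedBall (0 : E d) (r / 4)) with hv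
    have hv0 : 0 < v := Metric.measure_closedBall_pos _ _ (by positivity)
    refine ⟨ENNReal.ofReal ε * v * e, by
      refine ENNReal.mul_pos (mul_ne_zero ?_ hv0.ne') he.ne'
      simpa using hε, fun θ hθ => ?_⟩
    -- The aim point `z` lies on the segment from `θs` to `θ`, at distance at most `r / 2` from `θ`
    -- and at most `n r / 4` from `θs`. The ball of radius `r / 4` around `z` is thus reachable in
    -- one step and lies inside the region covered by the induction hypothesis.
    set t : ℝ := n / (n + 2) with ht
    set z := θs + t • (θ - θs) with hz
    have hn2 : (0 : ℝ) < n + 2 := by positivity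
    have ht0 : 0 ≤ t := by positivity
    have ht1 : 1 - t = 2 / (n + 2) := by
      rw [ht]
      field_simp
      ring
    have hzs : ‖z - θs‖ ≤ n * (r / 4) := by
      rw [hz, add_sub_cancel_left, norm_smul, Real.norm_of_nonneg ht0]
      calc t * ‖θ - θs‖ ≤ t * ((n + 1 + 1) * (r / 4)) := by gcongr
        _ = n * (r / 4) := by
          rw [ht]
          field_simp
          ring
    have hzθ : ‖z - θ‖ ≤ r / 2 := by
      have : z - θ = -((1 - t) • (θ - θs)) := by
        rw [hz, sub_smul, one_smul]
        abel
      rw [this, norm_neg, norm_smul, ht1, Real.norm_of_nonneg (by positivity)]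
      calc 2 / (n + 2 : ℝ) * ‖θ - θs‖ ≤ 2 / (n + 2) * ((n + 1 + 1) * (r / 4)) := by gcongr
        _ = r / 2 := by
          field_simp
          ring
    have hzball : Metric.closedBall z (r / 4) ⊆ Metric.closedBall θ r := by
      refine Metric.closedBall_subset_closedBall' ?_
      rw [dist_eq_norm]
      linarith
    refine Measure.le_iff.2 fun A hA => ?_
    rw [show n + 1 + 1 = 1 + (n + 1) by ring, Kernel.pow_add_apply_eq_lintegral P 1 (n + 1) θ hA,
      pow_one]
    have hvz : volume (Metric.closedBall z (r / 4)) = v := by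
      rw [hv, Measure.addHaar_closedBall_center]
    calc (ENNReal.ofReal ε * v * e) • volume.restrict (Metric.closedBall θs (r / 4)) A
        = ENNReal.ofReal ε * ∫⁻ _y in Metric.closedBall z (r / 4),
            (e • volume.restrict (Metric.closedBall θs (r / 4))) A := by
          rw [setLIntegral_const, hvz, Measure.smul_apply, smul_eq_mul, smul_eq_mul]
          ring
      _ ≤ ENNReal.ofReal ε * ∫⁻ y in Metric.closedBall z (r / 4), (P ^ (n + 1)) y A := by
          gcongr ENNReal.ofReal ε * ?_
          refine setLIntegral_mono ((P ^ (n + 1)).measurable_coe hA) fun y hy => ?_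
          refine hmin y ?_ A
          rw [Metric.mem_closedBall, dist_eq_norm] at hy
          calc ‖y - θs‖ ≤ ‖y - z‖ + ‖z - θs‖ := norm_sub_le_norm_sub_add_norm_sub _ _ _
            _ ≤ r / 4 + n * (r / 4) := add_le_add hy hzs
            _ = (n + 1) * (r / 4) := by ring
      _ ≤ ENNReal.ofReal ε * ∫⁻ y in Metric.closedBall θ r, (P ^ (n + 1)) y A := by
          gcongr
      _ = ∫⁻ y, (P ^ (n + 1)) y A ∂(ENNReal.ofReal ε • volume.restrict (Metric.closedBall θ r)) := by
          rw [lintegral_smul_measure, smul_eq_mul]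
      _ ≤ ∫⁻ y, (P ^ (n + 1)) y A ∂(P θ) := by
          refine lintegral_mono' (hlocal θ ?_) le_rfl
          refine hθ.trans (le_trans (le_of_eq ?_) hn)
          ring

lemma clippedStep_eq_of_norm_le {β τ : ℝ} {θ g : E d} (hg : ‖g‖ ≤ τ) :
    clippedStep β τ θ g = θ - β • g := by
  unfold clippedStep
  rcases eq_or_ne g 0 with rfl | hg0
  · simp
  · rw [min_eq_left ((one_le_div (norm_pos_iff.2 hg0)).2 hg), one_mul]

lemma measurable_clippedStep (β τ : ℝ) (θ : E d) : Measurable (clippedStep β τ θ) := by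
  unfold clippedStep
  exact measurable_const.sub
    (((measurable_const.min (measurable_const.div measurable_norm)).mul_const β).smul measurable_id)

lemma transition_apply (η : ℝ) (DO DI : Kernel (E d) (E d)) [IsMarkovKernel DO]
    [IsMarkovKernel DI] (β p : ℝ) (θ : E d) :
    transition η DO DI β p θ =
      (ENNReal.ofReal η • DO θ + ENNReal.ofReal (1 - η) • DI θ).map
        (clippedStep β (threshold DI p θ) θ) := rfl

lemma isMarkovKernel_transition {η : ℝ} (hη0 : 0 ≤ η) (hη1 : η ≤ 1) (DO DI : Kernel (E d) (E d))
    [IsMarkovKernel DO] [IsMarkovKernel DI] (β p : ℝ) :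
    IsMarkovKernel (transition η DO DI β p) := by
  refine ⟨fun θ => ⟨?_⟩⟩
  rw [transition_apply, Measure.map_apply (measurable_clippedStep _ _ _) MeasurableSet.univ]
  simp only [Set.preimage_univ, Measure.coe_add, Measure.coe_smul, Pi.add_apply, Pi.smul_apply,
    measure_univ, smul_eq_mul, mul_one]
  rw [← ENNReal.ofReal_add hη0 (by linarith)]
  simp

lemma volume_preimage_sub_smul (θ : E d) {β : ℝ} (hβ : 0 < β) {S : Set (E d)}
    (hS : MeasurableSet S) :
    volume ((fun g : E d => θ - β • g) ⁻¹' S) =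
      ENNReal.ofReal |(β ^ Module.finrank ℝ (E d))⁻¹| * volume S := by
  have h : (fun g : E d => θ - β • g) ⁻¹' S =
      (fun g : E d => β • g) ⁻¹' ((fun z => θ - z) ⁻¹' S) := rfl
  rw [h, Measure.addHaar_preimage_smul _ hβ.ne',
    (Measure.measurePreserving_sub_left volume θ).measure_preimage hS.nullMeasurableSet]

/-- Uniformly over a ball, one step of clipped SGD charges a neighbourhood of its starting point. -/
lemma exists_local_minorant_transition {f : E d → ℝ} {θs : E d} {L η p β : ℝ}
    (DO DI : Kernel (E d) (E d)) [IsMarkovKernel DO] [IsMarkovKernel DI] (hL : 0 ≤ L)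
    (hgrad : ∀ θ, ‖gradient f θ‖ ≤ L * ‖θ - θs‖) (hη1 : η < 1)
    (hnoise : DiffuseCenteredNoise f DI)
    (hτ : ∀ R : ℝ, ∃ c : ℝ, 0 < c ∧ ∀ θ, ‖θ‖ ≤ R → c ≤ threshold DI p θ) (hβ : 0 < β) (R : ℝ) :
    ∃ r ε : ℝ, 0 < r ∧ r ≤ 1 ∧ 0 < ε ∧ ∀ θ, ‖θ - θs‖ ≤ R →
      ENNReal.ofReal ε • volume.restrict (Metric.closedBall θ r) ≤ transition η DO DI β p θ := by
  obtain ⟨-, δ, ν₁, ν₂, h, κ, hδ0, -, -, hmix, hdens, hκ⟩ := hnoise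
  obtain ⟨c₀, hc₀, hc₀τ⟩ := hτ (R + ‖θs‖)
  -- Samples of norm at most `c` are unclipped; the cap `1 / β` makes the radius `β c` at most `1`,
  -- so that rounding up to a multiple of `r / 4` overshoots by less than `1`.
  set c := min c₀ (1 / β) with hc
  have hc0 : 0 < c := lt_min hc₀ (by positivity)
  have hr1 : β * c ≤ 1 := by
    calc β * c ≤ β * (1 / β) := by gcongr; exact min_le_right _ _
      _ = 1 := mul_one_div_cancel hβ.ne'
  set R' := c + L * |R| with hR'
  have hR'0 : 0 < R' := by positivity
  obtain ⟨hκ0, hκh⟩ := hκ R' hR'0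
  set vol := |(β ^ Module.finrank ℝ (E d))⁻¹| with hvol
  have hvol0 : 0 < vol := by positivity
  have h1η : 0 < 1 - η := by linarith
  refine ⟨β * c, (1 - η) * δ * κ R' * vol, by positivity, hr1, by positivity, fun θ hθ => ?_⟩
  have hcτ : c ≤ threshold DI p θ := by
    refine (min_le_left _ _).trans (hc₀τ θ ?_)
    calc ‖θ‖ = ‖(θ - θs) + θs‖ := by rw [sub_add_cancel]
      _ ≤ R + ‖θs‖ := (norm_add_le _ _).trans (by gcongr)
  refine Measure.le_iff.2 fun A hA => ?_
  set G := gradient f θ with hG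
  have hstep : Measurable fun g : E d => θ - β • g := by fun_prop
  set S := A ∩ Metric.closedBall θ (β * c) with hS
  have hSm : MeasurableSet S := hA.inter Metric.isClosed_closedBall.measurableSet
  set T := (fun g : E d => θ - β • g) ⁻¹' S with hT
  have hTm : MeasurableSet T := hstep hSm
  have hTc : ∀ g ∈ T, ‖g‖ ≤ c := fun g hg => by
    have := hg.2
    rw [Metric.mem_closedBall, dist_eq_norm, sub_sub_cancel_left, norm_neg, norm_smul,
      Real.norm_of_nonneg hβ.le] at this
    exact le_of_mul_le_mul_left this hβ
  set T' := (fun ω : E d => ω + G) ⁻¹' T with hT'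
  have hT'm : MeasurableSet T' := (measurable_add_const G) hTm
  have hT'b : T' ⊆ Metric.closedBall 0 R' := fun ω hω => by
    rw [mem_closedBall_zero_iff]
    calc ‖ω‖ = ‖(ω + G) - G‖ := by rw [add_sub_cancel_right]
      _ ≤ ‖ω + G‖ + ‖G‖ := norm_sub_le _ _
      _ ≤ c + L * |R| := by
        refine add_le_add (hTc _ hω) ((hgrad θ).trans ?_)
        gcongr
        exact hθ.trans (le_abs_self R)
  have hdensT : ENNReal.ofReal (κ R') * volume T' ≤ ν₁ θ T' := by
    rw [(hdens θ).2, withDensity_apply _ hT'm, ← setLIntegral_const]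
    refine setLIntegral_mono (hdens θ).1 fun ω hω => ?_
    exact (hκh θ).le.trans (iInf₂_le ω (hT'b hω))
  -- Only the diffuse component of the inlier noise is kept; the rest of the mixture is nonnegative.
  have hDI : ENNReal.ofReal δ * ν₁ θ T' ≤ DI θ T := by
    have e : DI θ T = ((DI θ).map fun g => g - G) T' := by
      rw [Measure.map_apply (measurable_sub_const G) hT'm]
      congr 1
      ext g
      simp [hT']
    rw [e, hmix θ]
    simp only [Measure.coe_add, Measure.coe_smul, Pi.add_apply, Pi.smul_apply, smul_eq_mul]
    exact le_self_add
  have hvolT : volume T' = ENNReal.ofReal vol * volume S := by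
    rw [hT', measure_preimage_add_right, hT, volume_preimage_sub_smul θ hβ hSm]
  have hsub : T ⊆ clippedStep β (threshold DI p θ) θ ⁻¹' A := fun g hg => by
    rw [Set.mem_preimage, clippedStep_eq_of_norm_le ((hTc g hg).trans hcτ)]
    exact hg.1
  rw [transition_apply, Measure.map_apply (measurable_clippedStep _ _ _) hA]
  simp only [Measure.coe_add, Measure.coe_smul, Pi.add_apply, Pi.smul_apply, smul_eq_mul]
  rw [Measure.restrict_apply hA]
  calc ENNReal.ofReal ((1 - η) * δ * κ R' * vol) * volume S
      = ENNReal.ofReal (1 - η) * (ENNReal.ofReal δ * (ENNReal.ofReal (κ R') *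
          (ENNReal.ofReal vol * volume S))) := by
        rw [ENNReal.ofReal_mul (by positivity), ENNReal.ofReal_mul (by positivity),
          ENNReal.ofReal_mul (by positivity)]
        ring
    _ ≤ ENNReal.ofReal (1 - η) * DI θ T := by
        gcongr
        rw [← hvolT]
        exact (mul_le_mul_right hdensT _).trans hDI
    _ ≤ ENNReal.ofReal (1 - η) * DI θ (clippedStep β (threshold DI p θ) θ ⁻¹' A) := by
        gcongr
    _ ≤ _ := le_add_self

/-- Iterates of clipped SGD are minorized on every ball around the minimizer. -/
theorem exists_pow_minorant_transition {f : E d → ℝ} {θs : E d} {L η p β : ℝ}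
    (DO DI : Kernel (E d) (E d)) [IsMarkovKernel DO] [IsMarkovKernel DI] (hL : 0 ≤ L)
    (hgrad : ∀ θ, ‖gradient f θ‖ ≤ L * ‖θ - θs‖) (hη0 : 0 ≤ η) (hη1 : η < 1)
    (hnoise : DiffuseCenteredNoise f DI)
    (hτ : ∀ R : ℝ, ∃ c : ℝ, 0 < c ∧ ∀ θ, ‖θ‖ ≤ R → c ≤ threshold DI p θ) (hβ : 0 < β) (R : ℝ) :
    ∃ m : ℕ, 0 < m ∧ ∃ ν : Measure (E d), 0 < ν.real Set.univ ∧
      ∀ θ, ‖θ - θs‖ ≤ R → ν ≤ (transition η DO DI β p ^ m) θ := by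
  have hMarkov := isMarkovKernel_transition hη0 hη1.le DO DI β p
  obtain ⟨r, ε, hr, hr1, hε, hlocal⟩ :=
    exists_local_minorant_transition DO DI hL hgrad hη1 hnoise hτ hβ (|R| + 1)
  set n := ⌊|R| / (r / 4)⌋₊ with hn
  have hr4 : 0 < r / 4 := by positivity
  have hlow : R ≤ (n + 1 : ℝ) * (r / 4) :=
    (le_abs_self R).trans ((div_le_iff₀ hr4).1 (Nat.lt_floor_add_one _).le)
  have hup : (n + 1 : ℝ) * (r / 4) ≤ |R| + 1 := by
    have := (le_div_iff₀ hr4).1 (Nat.floor_le (by positivity : 0 ≤ |R| / (r / 4)))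
    rw [← hn] at this
    nlinarith
  obtain ⟨e, he, hmin⟩ := exists_pow_minorant_of_local_minorant _ θs hr hε hlocal n hup
  refine ⟨n + 1, n.succ_pos, e • volume.restrict (Metric.closedBall θs (r / 4)), ?_,
    fun θ hθ => hmin θ (hθ.trans hlow)⟩
  have hle := hmin θs (by rw [sub_self, norm_zero]; positivity) Set.univ
  refine ENNReal.toReal_pos ?_ (hle.trans_lt (measure_lt_top _ _)).ne
  rw [Measure.smul_apply, smul_eq_mul, Measure.restrict_apply_univ]
  exact mul_ne_zero he.ne' (Metric.measure_closedBall_pos _ _ hr4).ne'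

end Minorization

/-! ### Smoothness and strong convexity at the minimizer -/

section Objective

variable {d : ℕ}

lemma gradient_eq_zero_of_forall_le {f : E d → ℝ} {θs : E d} (hmin : ∀ θ, f θs ≤ f θ) :
    gradient f θs = 0 := by
  have h : IsLocalMin f θs := Filter.Eventually.of_forall hmin
  rw [gradient, h.fderiv_eq_zero, map_zero]

lemma StronglyConvex.mul_norm_sq_le_inner {f : E d → ℝ} {μ : ℝ} (h : StronglyConvex f μ)
    {θs : E d} (hmin : ∀ θ, f θs ≤ f θ) (θ : E d) :
    μ * ‖θ - θs‖ ^ 2 ≤ inner ℝ (θ - θs) (gradient f θ) := by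
  have h1 := h.2 θ θs
  have h2 := h.2 θs θ
  rw [gradient_eq_zero_of_forall_le hmin, inner_zero_left] at h2
  rw [← neg_sub θ θs, inner_neg_right, real_inner_comm] at h1
  rw [norm_sub_rev θs θ] at h2
  linarith

/-- A gradient step of length `1 / L` from `θ` cannot go below the minimum, so `‖∇f θ‖² / (2 L) ≤ f
θ - f θs`; smoothness at `θs` bounds the right side by `L ‖θ - θs‖² / 2`. -/
lemma LipschitzSmooth.norm_gradient_le {f : E d → ℝ} {L : ℝ} (h : LipschitzSmooth f L)
    (hL : 0 < L) {θs : E d} (hmin : ∀ θ, f θs ≤ f θ) (θ : E d) :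
    ‖gradient f θ‖ ≤ L * ‖θ - θs‖ := by
  have h1 := h.2 θs θ
  rw [gradient_eq_zero_of_forall_le hmin, inner_zero_left, norm_sub_rev] at h1
  have h2 := h.2 θ (θ - L⁻¹ • gradient f θ)
  rw [sub_sub_cancel_left, inner_neg_right, real_inner_smul_right, real_inner_self_eq_norm_sq,
    sub_sub_cancel, norm_smul, Real.norm_of_nonneg (by positivity)] at h2
  have h3 := hmin (θ - L⁻¹ • gradient f θ)
  have e : L / 2 * (L⁻¹ * ‖gradient f θ‖) ^ 2 = L⁻¹ / 2 * ‖gradient f θ‖ ^ 2 := by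
    field_simp
  have h4 : L⁻¹ * ‖gradient f θ‖ ^ 2 ≤ L * ‖θ - θs‖ ^ 2 := by linarith
  rw [inv_mul_le_iff₀ hL] at h4
  refine abs_le_of_sq_le_sq' ?_ (by positivity) |>.2
  linarith

lemma le_of_stronglyConvex_of_lipschitzSmooth [Nontrivial (E d)] {f : E d → ℝ} {L μ : ℝ}
    (hf : LipschitzSmooth f L) (hc : StronglyConvex f μ) : μ ≤ L := by
  obtain ⟨x, y, hxy⟩ := exists_pair_ne (E d)
  have h1 := hf.2 x y
  have h2 := hc.2 x y
  have h3 : 0 < ‖x - y‖ ^ 2 := by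
    have := norm_pos_iff.2 (sub_ne_zero.2 hxy)
    positivity
  by_contra hcon
  nlinarith

end Objective

/-! ### Inequalities for `q`-th powers, `1 < q < 2` -/

section RpowInequalities

/-- The exponent `q - 2` is negative; at `a = 0` the identity survives because `0` to a nonzero
power is `0`. -/
lemma rpow_sub_two_mul_self {a q : ℝ} (ha : 0 ≤ a) (hq1 : 1 < q) (hq2 : q < 2) :
    a ^ (q - 2) * a = a ^ (q - 1) := by
  rcases ha.eq_or_lt with rfl | ha
  · rw [Real.zero_rpow (by linarith), Real.zero_rpow (by linarith), mul_zero]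
  · rw [← Real.rpow_add_one ha.ne']
    congr 1
    ring

lemma rpow_sub_two_mul_sq {a q : ℝ} (ha : 0 ≤ a) (hq1 : 1 < q) (hq2 : q < 2) :
    a ^ (q - 2) * a ^ 2 = a ^ q := by
  rw [sq, ← mul_assoc, rpow_sub_two_mul_self ha hq1 hq2]
  rcases ha.eq_or_lt with rfl | ha
  · rw [mul_zero, Real.zero_rpow (by linarith)]
  · rw [← Real.rpow_add_one ha.ne', sub_add_cancel]

lemma two_mul_rpow_le {a q : ℝ} (ha : 0 ≤ a) (hq2 : q ≤ 2) : (2 * a) ^ q ≤ 4 * a ^ q := by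
  rw [Real.mul_rpow (by norm_num) ha]
  have : (2 : ℝ) ^ q ≤ 2 ^ (2 : ℝ) := Real.rpow_le_rpow_of_exponent_le (by norm_num) hq2
  have h4 : (2 : ℝ) ^ (2 : ℝ) = 4 := by norm_num
  have := Real.rpow_nonneg ha q
  nlinarith

/-- Smoothness of the `q`-th power of the norm, for `1 < q < 2`. -/
lemma norm_sub_rpow_le {F : Type*} [NormedAddCommGroup F] [InnerProductSpace ℝ F] {q : ℝ}
    (hq1 : 1 < q) (hq2 : q < 2) (x y : F) :
    ‖x - y‖ ^ q ≤ ‖x‖ ^ q - q * ‖x‖ ^ (q - 2) * inner ℝ x y + 6 * ‖y‖ ^ q := by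
  have hx := norm_nonneg x
  have hy := norm_nonneg y
  rcases lt_or_ge ‖x‖ ‖y‖ with hlt | hge
  -- When `y` dominates, everything is compared with `‖y‖ ^ q`: the left side costs `4` and the
  -- inner product term `q ≤ 2`, whence the constant `6`.
  · have h1 : ‖x - y‖ ^ q ≤ 4 * ‖y‖ ^ q :=
      (Real.rpow_le_rpow (norm_nonneg _) ((norm_sub_le x y).trans (by linarith))
        (by linarith)).trans (two_mul_rpow_le hy hq2.le)
    have hpos : 0 < ‖y‖ := hx.trans_lt hlt
    have h2 : ‖x‖ ^ (q - 2) * inner ℝ x y ≤ ‖y‖ ^ q := by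
      calc ‖x‖ ^ (q - 2) * inner ℝ x y ≤ ‖x‖ ^ (q - 2) * (‖x‖ * ‖y‖) :=
            mul_le_mul_of_nonneg_left (real_inner_le_norm x y) (Real.rpow_nonneg hx _)
        _ = ‖x‖ ^ (q - 1) * ‖y‖ := by rw [← mul_assoc, rpow_sub_two_mul_self hx hq1 hq2]
        _ ≤ ‖y‖ ^ (q - 1) * ‖y‖ := by
            gcongr
        _ = ‖y‖ ^ q := by rw [← Real.rpow_add_one hpos.ne', sub_add_cancel]
    have h3 := Real.rpow_nonneg hx q
    have h4 := Real.rpow_nonneg hy q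
    nlinarith
  · rcases hx.eq_or_lt with h0 | hpos
    · have hx0 : x = 0 := norm_eq_zero.1 h0.symm
      have hy0 : y = 0 := norm_eq_zero.1 (le_antisymm (h0 ▸ hge) hy)
      simp [hx0, hy0, Real.zero_rpow (by linarith : q ≠ 0)]
    · set a := ‖x‖ with ha
      -- With `‖x - y‖² = a² (1 + s)`, Bernoulli's inequality for the concave power `q / 2` gives
      -- the first-order expansion directly.
      set s := (‖y‖ ^ 2 - 2 * inner ℝ x y) / a ^ 2 with hs
      have hsa : a ^ 2 * s = ‖y‖ ^ 2 - 2 * inner ℝ x y := by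
        rw [hs, mul_div_cancel₀ _ (by positivity)]
      have hsq : ‖x - y‖ ^ 2 = a ^ 2 * (1 + s) := by
        rw [norm_sub_sq_real, mul_add, hsa]
        ring
      have hs1 : 0 ≤ 1 + s := by
        by_contra hcon
        have := mul_pos (pow_pos hpos 2) (neg_pos.2 (not_le.1 hcon))
        nlinarith [sq_nonneg ‖x - y‖]
      have e : ‖x - y‖ ^ q = a ^ q * (1 + s) ^ (q / 2) := by
        have h2 : ∀ t : ℝ, 0 ≤ t → (t ^ 2) ^ (q / 2) = t ^ q := fun t ht => by
          rw [← Real.rpow_natCast, ← Real.rpow_mul ht]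
          congr 1
          push_cast
          ring
        rw [← h2 _ (norm_nonneg (x - y)), hsq, Real.mul_rpow (by positivity) hs1, h2 _ hx]
      have hB := rpow_one_add_le_one_add_mul_self (by linarith : -1 ≤ s)
        (by linarith : 0 ≤ q / 2) (by linarith)
      have h3 : a ^ (q - 2) * ‖y‖ ^ 2 ≤ ‖y‖ ^ q := by
        rcases hy.eq_or_lt with h0 | hypos
        · rw [← h0]
          simp [Real.zero_rpow (by linarith : q ≠ 0)]
        · rw [← rpow_sub_two_mul_sq hy hq1 hq2]
          gcongr ?_ * _
          exact Real.rpow_le_rpow_of_nonpos hypos hge (by linarith)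
      have h4 := Real.rpow_nonneg hy q
      calc ‖x - y‖ ^ q = a ^ q * (1 + s) ^ (q / 2) := e
        _ ≤ a ^ q * (1 + q / 2 * s) := by gcongr
        _ = a ^ q + q / 2 * (a ^ (q - 2) * (a ^ 2 * s)) := by
            rw [← rpow_sub_two_mul_sq hx hq1 hq2]
            ring
        _ = a ^ q - q * a ^ (q - 2) * inner ℝ x y + q / 2 * (a ^ (q - 2) * ‖y‖ ^ 2) := by
            rw [hsa]
            ring
        _ ≤ a ^ q - q * a ^ (q - 2) * inner ℝ x y + 6 * ‖y‖ ^ q := by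
            have : q / 2 * (a ^ (q - 2) * ‖y‖ ^ 2) ≤ 1 * ‖y‖ ^ q := by
              gcongr
              linarith
            linarith

lemma add_rpow_le_two_mul {a b q : ℝ} (ha : 0 ≤ a) (hb : 0 ≤ b) (hq1 : 1 ≤ q) (hq2 : q ≤ 2) :
    (a + b) ^ q ≤ 2 * (a ^ q + b ^ q) := by
  have h : (a + b) ^ q ≤ 2 ^ (q - 1) * (a ^ q + b ^ q) := by
    have := NNReal.rpow_add_le_mul_rpow_add_rpow ⟨a, ha⟩ ⟨b, hb⟩ hq1
    exact_mod_cast this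
  refine h.trans ?_
  have h2 : (2 : ℝ) ^ (q - 1) ≤ 2 ^ (1 : ℝ) :=
    Real.rpow_le_rpow_of_exponent_le (by norm_num) (by linarith)
  rw [Real.rpow_one] at h2
  have := Real.rpow_nonneg ha q
  have := Real.rpow_nonneg hb q
  gcongr

/-- Young's inequality with exponents `q` and `q / (q - 1)`, multiplied by `q`. -/
lemma mul_rpow_sub_one_le {a u q : ℝ} (ha : 0 ≤ a) (hu : 0 ≤ u) (hq1 : 1 < q) :
    q * (u * a ^ (q - 1)) ≤ u ^ q + (q - 1) * a ^ q := by
  have hq : 0 < q - 1 := by linarith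
  have h := Real.young_inequality_of_nonneg hu (Real.rpow_nonneg ha (q - 1))
    (Real.HolderConjugate.conjExponent hq1)
  have e : (a ^ (q - 1)) ^ (q.conjExponent) = a ^ q := by
    rw [← Real.rpow_mul ha, Real.conjExponent, mul_div_cancel₀ _ hq.ne']
  rw [e, Real.conjExponent] at h
  have := mul_le_mul_of_nonneg_left h (by linarith : 0 ≤ q)
  refine this.trans (le_of_eq ?_)
  field_simp

end RpowInequalities

/-! ### Arithmetic of the drift constants -/

section DriftArithmetic

/-- The one-step drift bound in closed form, from the constraints on the step size. -/
lemma drift_bound_le {L μ q A B η p β κ a : ℝ} (hL : 0 < L) (hq1 : 1 < q) (hq2 : q < 2)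
    (hA : 0 < A) (hB : 0 < B) (hη0 : 0 < η) (ha : 0 ≤ a)
    (hκ : κ = (1 - η) * p * μ - q * η * L - 2 * q * η ^ (1 - 1 / q) * A) (hκ0 : 0 < κ)
    (hβ0 : 0 < β) (hβη : β ≤ η / κ) (hβκ : β ≤ (κ / (86 * (L + A) ^ q)) ^ (1 / (q - 1))) :
    a ^ q - q * β * ((1 - η) * p * μ - η * L) * a ^ q +
        2 * q * β * η ^ (1 - 1 / q) * (A * a + B) * a ^ (q - 1) +
        12 * β ^ q * (L * a + (A * a + B)) ^ q ≤
      (1 - 62 / 86 * (β * κ)) * a ^ q + 28 * (β * κ) * (η ^ (1 - 1 / q) * B / κ) ^ q := by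
  set e := η ^ (1 - 1 / q) with he
  have he0 : 0 < e := Real.rpow_pos_of_pos hη0 _
  set u := e * B / κ with hu
  have hu0 : 0 < u := by positivity
  have hq' : 0 < q - 1 := by linarith
  have hβq : β ^ q = β * β ^ (q - 1) := by
    rw [mul_comm, ← Real.rpow_add_one hβ0.ne', sub_add_cancel]
  have haq : 0 ≤ a ^ q := Real.rpow_nonneg ha q
  have haq1 : a ^ (q - 1) * a = a ^ q := by
    rw [← rpow_sub_two_mul_self ha hq1 hq2, mul_assoc, ← sq, rpow_sub_two_mul_sq ha hq1 hq2]
  have hLA : 0 < (L + A) ^ q := Real.rpow_pos_of_pos (by linarith) _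
  -- The second step size constraint, raised to the power `q - 1`.
  have h1 : β ^ q * (L + A) ^ q ≤ β * κ / 86 := by
    have hZ : 0 ≤ κ / (86 * (L + A) ^ q) := by positivity
    have : β ^ (q - 1) ≤ κ / (86 * (L + A) ^ q) := by
      calc β ^ (q - 1) ≤ ((κ / (86 * (L + A) ^ q)) ^ (1 / (q - 1))) ^ (q - 1) := by gcongr
        _ = _ := by rw [← Real.rpow_mul hZ, one_div_mul_cancel hq'.ne', Real.rpow_one]
    calc β ^ q * (L + A) ^ q ≤ β * (κ / (86 * (L + A) ^ q)) * (L + A) ^ q := by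
          rw [hβq]
          gcongr
      _ = β * κ / 86 := by
          field_simp
  have hηe : η ^ (q - 1) = e ^ q := by
    rw [he, ← Real.rpow_mul hη0.le]
    congr 1
    field_simp
  -- The first constraint gives `β ^ (q - 1) ≤ (η / κ) ^ (q - 1)`, and `η ^ (q - 1) = e ^ q`.
  have h2 : β ^ q * B ^ q ≤ β * κ * u ^ q := by
    have : β ^ (q - 1) ≤ e ^ q / κ ^ (q - 1) := by
      rw [← hηe, ← Real.div_rpow hη0.le hκ0.le]
      gcongr
    have hκq : κ ^ q = κ ^ (q - 1) * κ := by rw [← Real.rpow_add_one hκ0.ne', sub_add_cancel]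
    have hκq1 : 0 < κ ^ (q - 1) := Real.rpow_pos_of_pos hκ0 _
    calc β ^ q * B ^ q ≤ β * (e ^ q / κ ^ (q - 1)) * B ^ q := by
          rw [hβq]
          gcongr
      _ = β * κ * u ^ q := by
          rw [hu, Real.div_rpow (by positivity) hκ0.le, Real.mul_rpow he0.le hB.le, hκq]
          field_simp
  have h3 : (L * a + (A * a + B)) ^ q ≤ 2 * ((L + A) ^ q * a ^ q + B ^ q) := by
    have := add_rpow_le_two_mul (a := (L + A) * a) (b := B) (by positivity) hB.le hq1.le hq2.le
    rw [Real.mul_rpow (by positivity) ha] at this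
    rwa [show L * a + (A * a + B) = (L + A) * a + B by ring]
  have h4 : 12 * β ^ q * (L * a + (A * a + B)) ^ q ≤
      24 / 86 * (β * κ) * a ^ q + 24 * (β * κ) * u ^ q := by
    have hβq0 : 0 < β ^ q := Real.rpow_pos_of_pos hβ0 _
    have e1 := mul_le_mul_of_nonneg_left h3 hβq0.le
    have e2 := mul_le_mul_of_nonneg_right h1 haq
    linarith
  have h5 : q * (2 * u * a ^ (q - 1)) ≤ 4 * u ^ q + (q - 1) * a ^ q :=
    (mul_rpow_sub_one_le ha (by positivity : 0 ≤ 2 * u) hq1).trans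
      (by linarith [two_mul_rpow_le hu0.le hq2.le])
  have h6 : κ ≤ (1 - η) * p * μ - η * L - 2 * e * A := by
    have i1 : 0 < η * L := by positivity
    have i2 : 0 < e * A := by positivity
    rw [hκ]
    nlinarith
  have h7 : e * B = κ * u := by
    rw [hu, mul_div_cancel₀ _ hκ0.ne']
  have h8 := mul_le_mul_of_nonneg_left h5 (by positivity : 0 ≤ β * κ)
  have h9 := mul_le_mul_of_nonneg_left h6 (by positivity : 0 ≤ q * β * a ^ q)
  have e3 : 2 * q * β * e * (A * a + B) * a ^ (q - 1) =
      2 * q * β * e * A * a ^ q + β * κ * (q * (2 * u * a ^ (q - 1))) := by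
    rw [← haq1]
    linear_combination 2 * q * β * a ^ (q - 1) * h7
  rw [e3]
  -- In units of `β κ`, the coefficient of `a ^ q` is `-q + (q - 1) + 24/86 = -62/86`, and that of
  -- `u ^ q` is `4 + 24 = 28`.
  nlinarith

end DriftArithmetic

/-! ### Quantiles and the clipping threshold -/

section Quantile

open Filter Topology

lemma bddBelow_quantile_set (ν : Measure ℝ) [IsProbabilityMeasure ν] {p : ℝ} (hp : 0 < p) :
    BddBelow {x : ℝ | p ≤ ν.real (Set.Iic x)} := by
  obtain ⟨y, hy⟩ := ((tendsto_order.1 (tendsto_cdf_atBot ν)).2 p hp).exists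
  refine ⟨y, fun x (hx : p ≤ ν.real (Set.Iic x)) => ?_⟩
  by_contra hcon
  rw [← cdf_eq_real] at hx
  linarith [monotone_cdf ν (not_le.1 hcon).le]

lemma quantile_le (ν : Measure ℝ) [IsProbabilityMeasure ν] {p x : ℝ} (hp : 0 < p)
    (h : p ≤ ν.real (Set.Iic x)) : quantile ν p ≤ x :=
  csInf_le (bddBelow_quantile_set ν hp) h

/-- The infimum is attained because distribution functions are right-continuous; `p < 1` makes the
set nonempty. -/
lemma le_measureReal_Iic_quantile (ν : Measure ℝ) [IsProbabilityMeasure ν] {p : ℝ} (hp : p < 1) :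
    p ≤ ν.real (Set.Iic (quantile ν p)) := by
  rw [← cdf_eq_real]
  have hne : {x : ℝ | p ≤ ν.real (Set.Iic x)}.Nonempty := by
    obtain ⟨y, hy⟩ := ((tendsto_order.1 (tendsto_cdf_atTop ν)).1 p hp).exists
    exact ⟨y, by rw [Set.mem_ofPred_eq, ← cdf_eq_real]; exact hy.le⟩
  have hright : Tendsto (cdf ν) (𝓝[>] (quantile ν p)) (𝓝 (cdf ν (quantile ν p))) :=
    ((cdf ν).right_continuous (quantile ν p)).mono Set.Ioi_subset_Ici_self
  refine ge_of_tendsto hright ?_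
  filter_upwards [self_mem_nhdsWithin] with x hx
  obtain ⟨y, hy, hyx⟩ := exists_lt_of_csInf_lt hne hx
  rw [Set.mem_ofPred_eq, ← cdf_eq_real] at hy
  exact hy.trans (monotone_cdf ν hyx.le)

variable {d : ℕ}

lemma measureReal_map_norm_Iic (DI : Kernel (E d) (E d)) (θ : E d) (x : ℝ) :
    ((DI θ).map (fun g => ‖g‖)).real (Set.Iic x) = (DI θ).real {g | ‖g‖ ≤ x} := by
  rw [Measure.real, Measure.map_apply measurable_norm measurableSet_Iic]
  rfl

lemma le_measureReal_norm_le_threshold (DI : Kernel (E d) (E d)) [IsMarkovKernel DI] {p : ℝ}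
    (hp : p < 1) (θ : E d) : p ≤ (DI θ).real {g | ‖g‖ ≤ threshold DI p θ} := by
  have := Measure.isProbabilityMeasure_map (μ := DI θ) measurable_norm.aemeasurable
  rw [← measureReal_map_norm_Iic]
  exact le_measureReal_Iic_quantile _ hp

lemma threshold_le (DI : Kernel (E d) (E d)) [IsMarkovKernel DI] {p x : ℝ} (hp : 0 < p) (θ : E d)
    (h : p ≤ (DI θ).real {g | ‖g‖ ≤ x}) : threshold DI p θ ≤ x := by
  have := Measure.isProbabilityMeasure_map (μ := DI θ) measurable_norm.aemeasurable
  rw [← measureReal_map_norm_Iic] at h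
  exact quantile_le _ hp h

end Quantile

/-! ### Consequences of the `L_q` error bound -/

section Moments

variable {d : ℕ} {m : Measure (E d)} [IsProbabilityMeasure m] {u : E d → E d} {q σ : ℝ}

lemma integral_norm_rpow_le_of_eLpNorm_le {ν : Measure (E d)} (hu : Measurable u) (hq : 0 < q) (hσ : 0 ≤ σ)
    (h : eLpNorm u (ENNReal.ofReal q) ν ≤ ENNReal.ofReal σ) :
    Integrable (fun g => ‖u g‖ ^ q) ν ∧ ∫ g, ‖u g‖ ^ q ∂ν ≤ σ ^ q := by
  have hq0 : ENNReal.ofReal q ≠ 0 := by simpa using hq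
  have hmem : MemLp u (ENNReal.ofReal q) ν :=
    ⟨hu.aestronglyMeasurable, h.trans_lt ENNReal.ofReal_lt_top⟩
  have hint := hmem.integrable_norm_rpow hq0 ENNReal.ofReal_ne_top
  rw [ENNReal.toReal_ofReal hq.le] at hint
  refine ⟨hint, ?_⟩
  rw [hmem.eLpNorm_eq_integral_rpow_norm hq0 ENNReal.ofReal_ne_top, ENNReal.toReal_ofReal hq.le,
    ENNReal.ofReal_le_ofReal_iff hσ] at h
  have hI : 0 ≤ ∫ g, ‖u g‖ ^ q ∂ν := integral_nonneg fun g => Real.rpow_nonneg (norm_nonneg _) _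
  have := Real.rpow_le_rpow (Real.rpow_nonneg hI _) h hq.le
  rwa [← Real.rpow_mul hI, inv_mul_cancel₀ hq.ne', Real.rpow_one] at this

lemma integral_norm_rpow_le_of_eLpNorm_sub_le (G : E d) (hq : 1 ≤ q) (hσ : 0 ≤ σ)
    (h : eLpNorm (fun g => g - G) (ENNReal.ofReal q) m ≤ ENNReal.ofReal σ) :
    Integrable (fun g : E d => ‖g‖ ^ q) m ∧ ∫ g, ‖g‖ ^ q ∂m ≤ (‖G‖ + σ) ^ q := by
  have hq0 : 0 < q := by linarith
  refine integral_norm_rpow_le_of_eLpNorm_le (u := fun g => g) measurable_id hq0 (by positivity) ?_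
  have e : (fun g : E d => g) = (fun _ => G) + fun g => g - G := by
    ext g
    simp
  rw [e]
  refine (eLpNorm_add_le aestronglyMeasurable_const (by fun_prop)
    (by simpa using hq)).trans ?_
  rw [ENNReal.ofReal_add (norm_nonneg _) hσ,
    eLpNorm_const _ (by simpa using hq0) (IsProbabilityMeasure.ne_zero m)]
  simp only [measure_univ, ENNReal.one_rpow, mul_one, ofReal_norm]
  gcongr

/-- Hölder's inequality on an event. -/
lemma setIntegral_norm_le_of_eLpNorm_le (hu : Measurable u) (hq : 1 ≤ q) (hσ : 0 ≤ σ)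
    (h : eLpNorm u (ENNReal.ofReal q) m ≤ ENNReal.ofReal σ) {S : Set (E d)} {η : ℝ} (hη : 0 ≤ η)
    (hS : m.real S ≤ η) : ∫ g in S, ‖u g‖ ∂m ≤ η ^ (1 - 1 / q) * σ := by
  have hq0 : 0 < q := by linarith
  have hexp : 0 ≤ 1 - 1 / q := by
    rw [sub_nonneg, div_le_one hq0]
    exact hq
  have hS' : m S ≤ ENNReal.ofReal η := by
    rw [← ofReal_measureReal (μ := m) (s := S)]
    exact ENNReal.ofReal_le_ofReal hS
  rw [integral_norm_eq_lintegral_enorm hu.aestronglyMeasurable]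
  refine ENNReal.toReal_le_of_le_ofReal (mul_nonneg (Real.rpow_nonneg hη _) hσ) ?_
  rw [← eLpNorm_one_eq_lintegral_enorm]
  refine (eLpNorm_le_eLpNorm_mul_rpow_measure_univ (q := ENNReal.ofReal q) (by simpa using hq)
    hu.aestronglyMeasurable).trans ?_
  rw [Measure.restrict_apply_univ, ENNReal.toReal_one, ENNReal.toReal_ofReal hq0.le, mul_comm,
    ENNReal.ofReal_mul (Real.rpow_nonneg hη _), ← ENNReal.ofReal_rpow_of_nonneg hη hexp, div_one]
  gcongr
  exact (eLpNorm_mono_measure _ Measure.restrict_le_self).trans h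

/-- Markov's inequality at the level with tail mass `η`. -/
lemma le_measureReal_norm_le_of_eLpNorm_le (hu : Measurable u) (hq : 0 < q) (hσ : 0 < σ)
    (h : eLpNorm u (ENNReal.ofReal q) m ≤ ENNReal.ofReal σ) {η : ℝ} (hη : 0 < η) :
    1 - η ≤ m.real {g | ‖u g‖ ≤ η ^ (-(1 / q)) * σ} := by
  obtain ⟨hint, hle⟩ := integral_norm_rpow_le_of_eLpNorm_le hu hq hσ.le h
  set t := η ^ (-(1 / q)) * σ with ht
  have ht0 : 0 < t := by positivity
  have htq : t ^ q * η = σ ^ q := by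
    rw [ht, Real.mul_rpow (by positivity) hσ.le, ← Real.rpow_mul hη.le, neg_mul,
      one_div_mul_cancel hq.ne', Real.rpow_neg_one]
    field_simp
  have hM := mul_meas_ge_le_integral_of_nonneg (μ := m)
    (Filter.Eventually.of_forall fun g => Real.rpow_nonneg (norm_nonneg (u g)) q) hint (t ^ q)
  have htq0 : 0 < t ^ q := by positivity
  have htail : m.real {g | ‖u g‖ ≤ t}ᶜ ≤ η := by
    have hsub : {g | ‖u g‖ ≤ t}ᶜ ⊆ {g | t ^ q ≤ ‖u g‖ ^ q} := fun g hg =>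
      Real.rpow_le_rpow ht0.le (lt_of_not_ge (by exact hg)).le hq.le
    have := measureReal_mono (μ := m) hsub
    have h2 : t ^ q * m.real {g | t ^ q ≤ ‖u g‖ ^ q} ≤ t ^ q * η := by linarith
    exact this.trans (le_of_mul_le_mul_left h2 htq0)
  rw [probReal_compl_eq_one_sub (measurableSet_le hu.norm measurable_const)] at htail
  linarith

end Moments

/-! ### Bias and moments of clipped samples -/

section Clipping

variable {d : ℕ}

/-- The gradient sample `g` clipped at the threshold `τ`. -/
noncomputable def clip (τ : ℝ) (g : E d) : E d := min 1 (τ / ‖g‖) • g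

lemma clippedStep_sub (β τ : ℝ) (θ θs g : E d) :
    clippedStep β τ θ g - θs = (θ - θs) - β • clip τ g := by
  rw [clippedStep, clip, smul_smul, mul_comm β]
  abel

lemma measurable_clip (τ : ℝ) : Measurable (clip τ : E d → E d) :=
  (measurable_const.min (measurable_const.div measurable_norm)).smul measurable_id

lemma norm_clip_le_threshold {τ : ℝ} (hτ : 0 ≤ τ) (g : E d) : ‖clip τ g‖ ≤ τ := by
  rcases eq_or_ne g 0 with rfl | hg
  · simpa [clip] using hτ
  · have hg' := norm_pos_iff.2 hg
    rw [clip, norm_smul, Real.norm_of_nonneg (le_min zero_le_one (by positivity))]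
    calc min 1 (τ / ‖g‖) * ‖g‖ ≤ τ / ‖g‖ * ‖g‖ := by gcongr; exact min_le_right _ _
      _ = τ := div_mul_cancel₀ _ hg'.ne'

lemma norm_clip_le_norm {τ : ℝ} (hτ : 0 ≤ τ) (g : E d) : ‖clip τ g‖ ≤ ‖g‖ := by
  rw [clip, norm_smul, Real.norm_of_nonneg (le_min zero_le_one (by positivity))]
  exact mul_le_of_le_one_left (norm_nonneg _) (min_le_left _ _)

lemma clip_eq_self {τ : ℝ} {g : E d} (hg : ‖g‖ ≤ τ) : clip τ g = g := by
  rcases eq_or_ne g 0 with rfl | hg0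
  · simp [clip]
  · rw [clip, min_eq_left ((one_le_div (norm_pos_iff.2 hg0)).2 hg), one_smul]

/-- A clipped sample is `c g` with `0 ≤ c ≤ 1`. Its signal `c ⟨x, G⟩` may be dropped, being
nonnegative, and replacing `c` by `1` in the noise costs at most `‖x‖ ‖g - G‖`. After integration
the full noise term vanishes by centering, and the cost is confined to the clipping event. -/
lemma inner_clip_ge {τ : ℝ} (hτ : 0 ≤ τ) (x G : E d) (hG : 0 ≤ inner ℝ x G) (g : E d) :
    {g : E d | ‖g‖ ≤ τ}.indicator (fun _ => inner ℝ x G) g + inner ℝ x (g - G) -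
      ‖x‖ * {g : E d | ‖g‖ ≤ τ}ᶜ.indicator (fun g => ‖g - G‖) g ≤ inner ℝ x (clip τ g) := by
  by_cases hg : ‖g‖ ≤ τ
  · rw [clip_eq_self hg, Set.indicator_of_mem (by exact hg),
      Set.indicator_of_notMem (by simpa using hg), inner_sub_right]
    linarith
  · rw [Set.indicator_of_notMem (by exact hg), Set.indicator_of_mem (by exact hg), clip,
      real_inner_smul_right]
    set c := min 1 (τ / ‖g‖) with hc
    have hc0 : 0 ≤ c := le_min zero_le_one (by positivity)
    have hc1 : c ≤ 1 := min_le_left _ _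
    have h1 : inner ℝ x g = inner ℝ x G + inner ℝ x (g - G) := by
      rw [inner_sub_right]
      ring
    have h2 := real_inner_le_norm x (g - G)
    have h3 : 0 ≤ ‖x‖ * ‖g - G‖ := by positivity
    rw [h1]
    nlinarith [mul_nonneg hc0 hG, mul_le_mul_of_nonneg_left h2 (by linarith : 0 ≤ 1 - c)]

/-- The mean of the clipped uncorrupted gradient still points towards the minimizer. -/
lemma integral_inner_clip_ge (m : Measure (E d)) [IsProbabilityMeasure m] {x G : E d}
    {μ q σ η p τ : ℝ} (hτ : 0 ≤ τ) (hμ : 0 ≤ μ) (hxG : μ * ‖x‖ ^ 2 ≤ inner ℝ x G) (hq : 1 ≤ q)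
    (hσ : 0 ≤ σ) (hη : 0 ≤ η) (hp : p = 1 - η)
    (hint : Integrable (fun g => g - G) m) (hmean : ∫ g, (g - G) ∂m = 0)
    (hmom : eLpNorm (fun g => g - G) (ENNReal.ofReal q) m ≤ ENNReal.ofReal σ)
    (hpτ : p ≤ m.real {g | ‖g‖ ≤ τ}) :
    p * μ * ‖x‖ ^ 2 - ‖x‖ * (η ^ (1 - 1 / q) * σ) ≤ ∫ g, inner ℝ x (clip τ g) ∂m := by
  have hS : MeasurableSet {g : E d | ‖g‖ ≤ τ} := measurableSet_le measurable_norm measurable_const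
  have hxG0 : 0 ≤ inner ℝ x G := le_trans (by positivity) hxG
  have i1 : Integrable ({g : E d | ‖g‖ ≤ τ}.indicator fun _ => (inner ℝ x G : ℝ)) m :=
    (integrable_const _).indicator hS
  have i2 : Integrable (fun g => (inner ℝ x (g - G) : ℝ)) m := hint.const_inner x
  have i3 : Integrable (fun g => ‖x‖ * {g : E d | ‖g‖ ≤ τ}ᶜ.indicator (fun g => ‖g - G‖) g) m :=
    (hint.norm.indicator hS.compl).const_mul _
  have i12 : Integrable (fun g => {g : E d | ‖g‖ ≤ τ}.indicator (fun _ => (inner ℝ x G : ℝ)) g +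
      inner ℝ x (g - G)) m := i1.add i2
  have hclip : Integrable (fun g => (inner ℝ x (clip τ g) : ℝ)) m := by
    refine Integrable.const_inner x (Integrable.of_bound (measurable_clip τ).aestronglyMeasurable τ
      (Filter.Eventually.of_forall fun g => norm_clip_le_threshold hτ g))
  have h := integral_mono (i12.sub i3) hclip (fun g => inner_clip_ge hτ x G hxG0 g)
  have e : ∫ g, ({g : E d | ‖g‖ ≤ τ}.indicator (fun _ => (inner ℝ x G : ℝ)) g + inner ℝ x (g - G) -
      ‖x‖ * {g : E d | ‖g‖ ≤ τ}ᶜ.indicator (fun g => ‖g - G‖) g) ∂m =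
      m.real {g | ‖g‖ ≤ τ} * inner ℝ x G -
        ‖x‖ * ∫ g in {g : E d | ‖g‖ ≤ τ}ᶜ, ‖g - G‖ ∂m := by
    rw [integral_sub i12 i3, integral_add i1 i2, integral_indicator_const _ hS,
      integral_inner hint, hmean, integral_const_mul, integral_indicator hS.compl]
    simp
  have h' := e.symm.le.trans h
  have hHol := setIntegral_norm_le_of_eLpNorm_le (m := m) (S := {g : E d | ‖g‖ ≤ τ}ᶜ)
    (by fun_prop) hq hσ hmom hη (by
      rw [probReal_compl_eq_one_sub hS]
      linarith)
  have h1 : p * (μ * ‖x‖ ^ 2) ≤ m.real {g | ‖g‖ ≤ τ} * inner ℝ x G :=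
    mul_le_mul hpτ hxG (by positivity) measureReal_nonneg
  have h2 := mul_le_mul_of_nonneg_left hHol (norm_nonneg x)
  linarith

/-- The clipping threshold of a sample with mean `G` and centered `q`-th moment at most `σ ^ q`. -/
lemma threshold_le_of_eLpNorm_le (DI : Kernel (E d) (E d)) [IsMarkovKernel DI] (θ G : E d)
    {q σ η p : ℝ} (hq : 0 < q) (hσ : 0 < σ) (hη0 : 0 < η) (hη1 : η < 1) (hp : p = 1 - η)
    (hmom : eLpNorm (fun g => g - G) (ENNReal.ofReal q) (DI θ) ≤ ENNReal.ofReal σ) :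
    threshold DI p θ ≤ ‖G‖ + η ^ (-(1 / q)) * σ := by
  refine threshold_le DI (by linarith) θ ?_
  rw [hp]
  refine (le_measureReal_norm_le_of_eLpNorm_le (by fun_prop) hq hσ hmom hη0).trans
    (measureReal_mono fun g hg => ?_)
  have hg' : ‖g - G‖ ≤ η ^ (-(1 / q)) * σ := hg
  rw [Set.mem_ofPred_eq]
  calc ‖g‖ = ‖G + (g - G)‖ := by rw [add_sub_cancel]
    _ ≤ ‖G‖ + ‖g - G‖ := norm_add_le _ _
    _ ≤ _ := by gcongr

lemma integrable_norm_sub_clip_rpow (m : Measure (E d)) [IsFiniteMeasure m] (x : E d) {β τ q : ℝ}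
    (hβ : 0 ≤ β) (hτ : 0 ≤ τ) (hq : 0 ≤ q) :
    Integrable (fun g => ‖x - β • clip τ g‖ ^ q) m := by
  refine Integrable.of_bound
    ((measurable_const.sub ((measurable_clip τ).const_smul β)).norm.pow_const q).aestronglyMeasurable
    ((‖x‖ + β * τ) ^ q) (Filter.Eventually.of_forall fun g => ?_)
  rw [Real.norm_of_nonneg (Real.rpow_nonneg (norm_nonneg _) _)]
  refine Real.rpow_le_rpow (norm_nonneg _) ((norm_sub_le _ _).trans ?_) hq
  rw [norm_smul, Real.norm_of_nonneg hβ]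
  gcongr
  exact norm_clip_le_threshold hτ g

/-- Drift of an arbitrary clipped sample. -/
lemma integral_norm_sub_clip_rpow_le (m : Measure (E d)) [IsProbabilityMeasure m] (x : E d)
    {β τ q : ℝ} (hβ : 0 ≤ β) (hτ : 0 ≤ τ) (hq1 : 1 < q) (hq2 : q < 2) :
    ∫ g, ‖x - β • clip τ g‖ ^ q ∂m ≤
      ‖x‖ ^ q + q * β * ‖x‖ ^ (q - 1) * τ + 6 * β ^ q * τ ^ q := by
  have hpt : ∀ g : E d, ‖x - β • clip τ g‖ ^ q ≤
      ‖x‖ ^ q + q * β * ‖x‖ ^ (q - 1) * τ + 6 * β ^ q * τ ^ q := fun g => by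
    have h := norm_sub_rpow_le hq1 hq2 x (β • clip τ g)
    have hc := norm_clip_le_threshold hτ g
    rw [real_inner_smul_right, norm_smul, Real.norm_of_nonneg hβ,
      Real.mul_rpow hβ (norm_nonneg _)] at h
    have h1 : -inner ℝ x (clip τ g) ≤ ‖x‖ * τ :=
      (neg_le_abs _).trans ((abs_real_inner_le_norm _ _).trans (by gcongr))
    have hw : 0 ≤ q * β * ‖x‖ ^ (q - 2) := by positivity
    have h2 := mul_le_mul_of_nonneg_left h1 hw
    have e : q * β * ‖x‖ ^ (q - 2) * (‖x‖ * τ) = q * β * ‖x‖ ^ (q - 1) * τ := by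
      rw [← rpow_sub_two_mul_self (norm_nonneg x) hq1 hq2]
      ring
    have h3 : 6 * (β ^ q * ‖clip τ g‖ ^ q) ≤ 6 * (β ^ q * τ ^ q) := by gcongr
    linarith
  refine (integral_mono (integrable_norm_sub_clip_rpow m x hβ hτ (by linarith))
    (integrable_const _) hpt).trans_eq (by simp)

/-- Drift of a clipped sample in terms of its mean direction and `q`-th moment. -/
lemma integral_norm_sub_clip_rpow_le_of_moment (m : Measure (E d)) [IsProbabilityMeasure m]
    (x : E d) {β τ q D : ℝ} (hβ : 0 ≤ β) (hτ : 0 ≤ τ) (hq1 : 1 < q) (hq2 : q < 2)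
    (hint : Integrable (fun g : E d => ‖g‖ ^ q) m) (hD : ∫ g, ‖g‖ ^ q ∂m ≤ D) :
    ∫ g, ‖x - β • clip τ g‖ ^ q ∂m ≤
      ‖x‖ ^ q - q * β * ‖x‖ ^ (q - 2) * ∫ g, inner ℝ x (clip τ g) ∂m + 6 * β ^ q * D := by
  have hclip : Integrable (fun g => (inner ℝ x (clip τ g) : ℝ)) m :=
    Integrable.const_inner x (Integrable.of_bound (measurable_clip τ).aestronglyMeasurable τ
      (Filter.Eventually.of_forall fun g => norm_clip_le_threshold hτ g))
  have hpt : ∀ g : E d, ‖x - β • clip τ g‖ ^ q ≤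
      ‖x‖ ^ q - q * β * ‖x‖ ^ (q - 2) * inner ℝ x (clip τ g) + 6 * β ^ q * ‖g‖ ^ q := fun g => by
    have h := norm_sub_rpow_le hq1 hq2 x (β • clip τ g)
    have hc := norm_clip_le_norm hτ g
    rw [real_inner_smul_right, norm_smul, Real.norm_of_nonneg hβ,
      Real.mul_rpow hβ (norm_nonneg _)] at h
    have h3 : 6 * (β ^ q * ‖clip τ g‖ ^ q) ≤ 6 * (β ^ q * ‖g‖ ^ q) := by gcongr
    linarith
  have i1 : Integrable (fun g : E d => ‖x‖ ^ q -
      q * β * ‖x‖ ^ (q - 2) * inner ℝ x (clip τ g)) m :=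
    (integrable_const _).sub (hclip.const_mul _)
  have i2 := hint.const_mul (6 * β ^ q)
  refine (integral_mono (integrable_norm_sub_clip_rpow m x hβ hτ (by linarith))
    (i1.add i2) hpt).trans ?_
  simp only [Pi.add_apply]
  rw [integral_add i1 i2, integral_sub (integrable_const _) (hclip.const_mul _),
    integral_const_mul, integral_const_mul]
  simp only [integral_const, probReal_univ, smul_eq_mul, one_mul]
  gcongr

end Clipping

/-! ### One-step drift of the corrupted chain -/

section Drift

variable {d : ℕ}

/-- Outliers and inliers contribute equally to two error terms: `η τ` and the Hölder bias each give
`η ^ (1 - 1/q) σ`, hence the `2`, and the two remainders with constant `6` add up to `12`. -/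
lemma norm_rpow_integral_corrupted_le {η p μ L q σ β τ : ℝ} (mO mI : Measure (E d))
    [IsProbabilityMeasure mO] [IsProbabilityMeasure mI] (x G : E d) (hη0 : 0 < η) (hη1 : η < 1)
    (hp : p = 1 - η) (hμ : 0 ≤ μ) (hL : 0 ≤ L) (hq1 : 1 < q) (hq2 : q < 2) (hσ : 0 < σ)
    (hβ : 0 ≤ β) (hτ : 0 ≤ τ) (hxG : μ * ‖x‖ ^ 2 ≤ inner ℝ x G) (hG : ‖G‖ ≤ L * ‖x‖)
    (hint : Integrable (fun g => g - G) mI) (hmean : ∫ g, (g - G) ∂mI = 0)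
    (hmom : eLpNorm (fun g => g - G) (ENNReal.ofReal q) mI ≤ ENNReal.ofReal σ)
    (hpτ : p ≤ mI.real {g | ‖g‖ ≤ τ}) (hτσ : τ ≤ ‖G‖ + η ^ (-(1 / q)) * σ) :
    η * ∫ g, ‖x - β • clip τ g‖ ^ q ∂mO + (1 - η) * ∫ g, ‖x - β • clip τ g‖ ^ q ∂mI ≤
      ‖x‖ ^ q - q * β * ((1 - η) * p * μ - η * L) * ‖x‖ ^ q +
        2 * q * β * η ^ (1 - 1 / q) * σ * ‖x‖ ^ (q - 1) +
        12 * β ^ q * (L * ‖x‖ + σ) ^ q := by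
  set a := ‖x‖ with ha
  have ha0 : 0 ≤ a := norm_nonneg x
  set e := η ^ (1 - 1 / q) with he
  have he0 : 0 < e := Real.rpow_pos_of_pos hη0 _
  have hηe : η * η ^ (-(1 / q)) = e := by
    rw [he, sub_eq_add_neg, Real.rpow_add hη0, Real.rpow_one]
  have h1η : 0 < 1 - η := by linarith
  obtain ⟨hgi, hgD⟩ := integral_norm_rpow_le_of_eLpNorm_sub_le (m := mI) G hq1.le hσ.le hmom
  have hD : (‖G‖ + σ) ^ q ≤ (L * a + σ) ^ q := by gcongr
  have hO := integral_norm_sub_clip_rpow_le mO x hβ hτ hq1 hq2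
  have hI := integral_norm_sub_clip_rpow_le_of_moment mI x hβ hτ hq1 hq2 hgi (hgD.trans hD)
  have hdir := integral_inner_clip_ge mI hτ hμ hxG hq1.le hσ.le hη0.le hp hint hmean hmom hpτ
  rw [← ha] at hO hI
  have hητ : η * τ ≤ η * L * a + e * σ := by
    calc η * τ ≤ η * (‖G‖ + η ^ (-(1 / q)) * σ) := by gcongr
      _ = η * ‖G‖ + e * σ := by rw [← hηe]; ring
      _ ≤ η * (L * a) + e * σ := by gcongr
      _ = _ := by ring
  -- The weight `η = (η ^ (1/q)) ^ q` exactly cancels the factor `η ^ (-1/q)` in the threshold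
  -- bound.
  have hητq : η * τ ^ q ≤ (L * a + σ) ^ q := by
    have hη1q : η ^ (1 / q) ≤ 1 := Real.rpow_le_one hη0.le hη1.le (by positivity)
    have e1 : η * τ ^ q = (η ^ (1 / q) * τ) ^ q := by
      rw [Real.mul_rpow (by positivity) hτ, ← Real.rpow_mul hη0.le,
        one_div_mul_cancel (by linarith), Real.rpow_one]
    rw [e1]
    refine Real.rpow_le_rpow (by positivity) ?_ (by linarith)
    calc η ^ (1 / q) * τ ≤ η ^ (1 / q) * (‖G‖ + η ^ (-(1 / q)) * σ) := by gcongr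
      _ = η ^ (1 / q) * ‖G‖ + (η ^ (1 / q) * η ^ (-(1 / q))) * σ := by ring
      _ = η ^ (1 / q) * ‖G‖ + σ := by
          rw [← Real.rpow_add hη0, add_neg_cancel, Real.rpow_zero, one_mul]
      _ ≤ 1 * (L * a) + σ := by gcongr
      _ = L * a + σ := by rw [one_mul]
  have hw : 0 ≤ q * β * a ^ (q - 2) := by positivity
  have e1 : a ^ (q - 2) * a = a ^ (q - 1) := rpow_sub_two_mul_self ha0 hq1 hq2
  have e2 : a ^ (q - 2) * a ^ 2 = a ^ q := rpow_sub_two_mul_sq ha0 hq1 hq2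
  have e3 : a ^ (q - 1) * a = a ^ q := by rw [← e1, ← e2]; ring
  have h1 := mul_le_mul_of_nonneg_left hdir hw
  have h2 : q * β * a ^ (q - 2) * (p * μ * a ^ 2 - a * (e * σ)) =
      q * β * p * μ * a ^ q - q * β * e * σ * a ^ (q - 1) := by
    rw [← e1, ← e2]
    ring
  have hβq : 0 ≤ β ^ q := Real.rpow_nonneg hβ q
  have haq1 : 0 ≤ q * β * a ^ (q - 1) := by positivity
  set D := (L * a + σ) ^ q with hDdef
  have hD0 : 0 ≤ D := by positivity
  have hI' : ∫ g, ‖x - β • clip τ g‖ ^ q ∂mI ≤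
      a ^ q - (q * β * p * μ * a ^ q - q * β * e * σ * a ^ (q - 1)) + 6 * β ^ q * D := by
    linarith
  have h3 := mul_le_mul_of_nonneg_left hI' h1η.le
  have h4 := mul_le_mul_of_nonneg_left hO hη0.le
  have h5 := mul_le_mul_of_nonneg_left hητ haq1
  have h6 := mul_le_mul_of_nonneg_left hητq hβq
  have h7 : (1 - η) * (q * β * e * σ * a ^ (q - 1)) ≤ q * β * e * σ * a ^ (q - 1) :=
    mul_le_of_le_one_left (by positivity) (by linarith)
  have h8 : (1 - η) * (6 * β ^ q * D) ≤ 6 * β ^ q * D :=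
    mul_le_of_le_one_left (by positivity) (by linarith)
  have h9 : q * β * a ^ (q - 1) * (η * L * a + e * σ) =
      q * β * η * L * a ^ q + q * β * e * σ * a ^ (q - 1) := by
    rw [← e3]
    ring
  linarith

/-- Geometric drift of clipped SGD for the `q`-th power of the distance to the minimizer. -/
theorem lintegral_transition_le {f : E d → ℝ} {θs : E d} {L μ q A B η p β κ : ℝ}
    (DO DI : Kernel (E d) (E d)) [IsMarkovKernel DO] [IsMarkovKernel DI] (hL : 0 < L)
    (hgrad : ∀ θ, ‖gradient f θ‖ ≤ L * ‖θ - θs‖) (hconvex : StronglyConvex f μ)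
    (hmin : ∀ θ, f θs ≤ f θ) (hη0 : 0 < η) (hη1 : η < 1 / 2) (hnoise : DiffuseCenteredNoise f DI)
    (hq1 : 1 < q) (hq2 : q < 2) (hmoment : GradientErrorMoment f DI θs q A B) (hp : p = 1 - η)
    (hτ : ∀ θ, 0 ≤ threshold DI p θ)
    (hκ : κ = (1 - η) * p * μ - q * η * L - 2 * q * η ^ (1 - 1 / q) * A) (hκ0 : 0 < κ)
    (hβ0 : 0 < β) (hβη : β ≤ η / κ) (hβκ : β ≤ (κ / (86 * (L + A) ^ q)) ^ (1 / (q - 1)))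
    (θ : E d) :
    ∫⁻ y, ENNReal.ofReal (‖y - θs‖ ^ q) ∂(transition η DO DI β p θ) ≤
      ENNReal.ofReal ((1 - 62 / 86 * (β * κ)) * ‖θ - θs‖ ^ q +
        28 * (β * κ) * (η ^ (1 - 1 / q) * B / κ) ^ q) := by
  obtain ⟨hA, hB, hmom⟩ := hmoment
  have hσ : 0 < A * ‖θ - θs‖ + B := by positivity
  have hthr := threshold_le_of_eLpNorm_le DI θ (gradient f θ) (by linarith) hσ hη0 (by linarith) hp
    (hmom θ)
  have h1 := norm_rpow_integral_corrupted_le (DO θ) (DI θ) (θ - θs) (gradient f θ) hη0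
    (by linarith) hp hconvex.1.le hL.le hq1 hq2 hσ hβ0.le (hτ θ)
    (hconvex.mul_norm_sq_le_inner hmin θ) (hgrad θ) (hnoise.1 θ).1 (hnoise.1 θ).2 (hmom θ)
    (le_measureReal_norm_le_threshold DI (by linarith) θ) hthr
  have h2 := drift_bound_le hL hq1 hq2 hA hB hη0 (norm_nonneg (θ - θs)) hκ hκ0 hβ0 hβη hβκ
  have hm : Measurable fun y : E d => ENNReal.ofReal (‖y - θs‖ ^ q) :=
    ((measurable_sub_const θs).norm.pow_const q).ennreal_ofReal
  have hint : ∀ m : Measure (E d), IsProbabilityMeasure m →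
      ∫⁻ g, ENNReal.ofReal (‖clippedStep β (threshold DI p θ) θ g - θs‖ ^ q) ∂m =
        ENNReal.ofReal (∫ g, ‖(θ - θs) - β • clip (threshold DI p θ) g‖ ^ q ∂m) := by
    intro m _
    simp_rw [clippedStep_sub]
    exact (ofReal_integral_eq_lintegral_ofReal
      (integrable_norm_sub_clip_rpow m _ hβ0.le (hτ θ) (by linarith))
      (Filter.Eventually.of_forall fun g => Real.rpow_nonneg (norm_nonneg _) _)).symm
  have hnn : ∀ m : Measure (E d),
      0 ≤ ∫ g, ‖(θ - θs) - β • clip (threshold DI p θ) g‖ ^ q ∂m := fun m =>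
    integral_nonneg fun g => Real.rpow_nonneg (norm_nonneg _) _
  have h1η : 0 ≤ 1 - η := by linarith
  rw [transition_apply, lintegral_map hm (measurable_clippedStep _ _ _), lintegral_add_measure,
    lintegral_smul_measure, lintegral_smul_measure, hint _ inferInstance, hint _ inferInstance,
    smul_eq_mul, smul_eq_mul, ← ENNReal.ofReal_mul hη0.le, ← ENNReal.ofReal_mul h1η,
    ← ENNReal.ofReal_add (mul_nonneg hη0.le (hnn _)) (mul_nonneg h1η (hnn _))]
  exact ENNReal.ofReal_le_ofReal (h1.trans h2)

end Drift

/-! ### Laws of the iterates and nondegeneracy of the space -/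

section Iterates

variable {d : ℕ}

lemma lawAt_dirac_eq_pow (P : Kernel (E d) (E d)) (θ : E d) (n : ℕ) :
    lawAt P (Measure.dirac θ) n = (P ^ n) θ := by
  induction n with
  | zero => exact (Kernel.id_apply θ).symm
  | succ n ih =>
    rw [lawAt, Function.iterate_succ_apply', pow_succ']
    change (lawAt P (Measure.dirac θ) n).bind P = (P ∘ₖ (P ^ n)) θ
    rw [ih, Kernel.comp_apply]

/-- Excludes dimension zero, where the sample norm, and so the threshold, would vanish. This is what
yields `μ ≤ L`, hence `0 < L`. -/
lemma nontrivial_of_threshold_pos (DI : Kernel (E d) (E d)) [IsMarkovKernel DI] {p : ℝ}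
    (hp0 : 0 < p) (hp1 : p ≤ 1) (θ : E d) (h : 0 < threshold DI p θ) : Nontrivial (E d) := by
  by_contra hcon
  rw [not_nontrivial_iff_subsingleton] at hcon
  refine h.not_ge (threshold_le DI hp0 θ ?_)
  have : {g : E d | ‖g‖ ≤ 0} = Set.univ := Set.eq_univ_of_forall fun g => by
    simp [Subsingleton.elim g 0]
  rw [this, probReal_univ]
  exact hp1

end Iterates

end QCSGD

/-! ### Ergodicity and stationary moment of clipped SGD -/

theorem proposition8 (d : ℕ) (f : QCSGD.E d → ℝ) (θs : QCSGD.E d)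
    (L μ q A B η p β κ' : ℝ)
    (DO DI : Kernel (QCSGD.E d) (QCSGD.E d)) [IsMarkovKernel DO] [IsMarkovKernel DI]
    (hsmooth : QCSGD.LipschitzSmooth f L)
    (hconvex : QCSGD.StronglyConvex f μ)
    (hmin : ∀ θ, f θs ≤ f θ)
    (hη0 : 0 ≤ η) (hη : η < 1 / 2)
    (hnoise : QCSGD.DiffuseCenteredNoise f DI)
    (hq1 : 1 < q) (hq2 : q < 2)
    (hmoment : QCSGD.GradientErrorMoment f DI θs q A B)
    (hp : p = 1 - η)
    -- the clipping thresholds are bounded away from zero on bounded sets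
    (hτ : ∀ R : ℝ, ∃ c : ℝ, 0 < c ∧ ∀ θ, ‖θ‖ ≤ R → c ≤ QCSGD.threshold DI p θ)
    (hκ' : κ' = (1 - η) * p * μ - q * η * L - 2 * q * η ^ (1 - 1 / q) * A)
    (hκ'_pos : 0 < κ')
    (hβ0 : 0 < β)
    (hβ : β ≤ min (η / κ') ((κ' / (86 * (L + A) ^ q)) ^ (1 / (q - 1)))) :
    ∃ π : Measure (QCSGD.E d),
      IsProbabilityMeasure π ∧
      (QCSGD.transition η DO DI β p).Invariant π ∧
      (∀ π' : Measure (QCSGD.E d), IsProbabilityMeasure π' →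
        (QCSGD.transition η DO DI β p).Invariant π' → π' = π) ∧
      (∀ θ₀ : QCSGD.E d, ∃ ρ M : ℝ, 0 ≤ ρ ∧ ρ < 1 ∧ ∀ T : ℕ,
        QCSGD.tvDist (QCSGD.lawAt (QCSGD.transition η DO DI β p) (Measure.dirac θ₀) T) π ≤
          M * ρ ^ T * (1 + ‖θ₀ - θs‖ ^ 2)) ∧
      Integrable (fun θ => ‖θ - θs‖ ^ q) π ∧
      ∫ θ, ‖θ - θs‖ ^ q ∂π ≤ 128 * (η ^ (1 - 1 / q) * B / κ') ^ q := by
  have hβη : β ≤ η / κ' := hβ.trans (min_le_left _ _)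
  have hβκ := hβ.trans (min_le_right _ _)
  have hβκη : β * κ' ≤ η := (le_div_iff₀ hκ'_pos).1 hβη
  have hbk : 0 < β * κ' := by positivity
  -- The case `η = 0` is vacuous: a positive step size cannot satisfy `β ≤ η / κ'`.
  have hηpos : 0 < η := hbk.trans_le hβκη
  have hB := hmoment.2.1
  have hτpos : ∀ θ, 0 < QCSGD.threshold DI p θ := fun θ => by
    obtain ⟨c, hc, h⟩ := hτ ‖θ‖
    exact hc.trans_le (h θ le_rfl)
  have hnontriv := QCSGD.nontrivial_of_threshold_pos DI (by linarith) (by linarith) θs (hτpos θs)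
  have hL : 0 < L :=
    hconvex.1.trans_le (QCSGD.le_of_stronglyConvex_of_lipschitzSmooth hsmooth hconvex)
  have hgrad := hsmooth.norm_gradient_le hL hmin
  have hMarkov := QCSGD.isMarkovKernel_transition hη0 (by linarith) DO DI β p
  set V : QCSGD.E d → ℝ := fun θ => ‖θ - θs‖ ^ q with hV
  have hVm : Measurable V := (measurable_sub_const θs).norm.pow_const q
  have hV0 : ∀ θ, 0 ≤ V θ := fun θ => Real.rpow_nonneg (norm_nonneg _) _
  set U := (η ^ (1 - 1 / q) * B / κ') ^ q with hU
  have hU0 : 0 ≤ U := by positivity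
  have hdrift := QCSGD.lintegral_transition_le DO DI hL hgrad hconvex hmin hηpos hη hnoise hq1 hq2
    hmoment hp (fun θ => (hτpos θ).le) hκ' hκ'_pos hβ0 hβη hβκ
  obtain ⟨π, hπ, hinv, huniq, ⟨ρ, hρ0, hρ1, hconv⟩, hmom⟩ :=
    QCSGD.harris_theorem (QCSGD.transition η DO DI β p) hVm hV0
      (γ := 1 - 62 / 86 * (β * κ')) (K := 28 * (β * κ') * U) (by linarith) (by linarith)
      (by positivity) hdrift (fun R => by
        obtain ⟨m, hm, ν, hν, hle⟩ := QCSGD.exists_pow_minorant_transition DO DI hL.le hgrad hη0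
          (by linarith) hnoise hτ hβ0 (|R| ^ (1 / q))
        refine ⟨m, hm, ν, hν, fun θ hθ => hle θ ?_⟩
        calc ‖θ - θs‖ = (‖θ - θs‖ ^ q) ^ (1 / q) := by
              rw [← Real.rpow_mul (norm_nonneg _), mul_one_div_cancel (by linarith), Real.rpow_one]
          _ ≤ |R| ^ (1 / q) := by
              gcongr
              exact hθ.trans (le_abs_self R))
  -- The ratio is `28 · 86 / 62 < 39`, independent of `β`.
  have hK : 28 * (β * κ') * U / (1 - (1 - 62 / 86 * (β * κ'))) ≤ 128 * U := by
    rw [div_le_iff₀ (by linarith)]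
    nlinarith [mul_nonneg hbk.le hU0]
  have hVs : V θs = 0 := by
    simp [hV, Real.zero_rpow (by linarith : q ≠ 0)]
  -- Starting the chain at `θs`, where `V` vanishes, removes the initial term from the moment bound.
  have hmoms : ∫⁻ θ, ENNReal.ofReal (V θ) ∂π ≤ ENNReal.ofReal (128 * U) :=
    (hmom θs).trans (ENNReal.ofReal_le_ofReal (by rw [hVs, zero_add]; exact hK))
  obtain ⟨hVi, hVle⟩ :=
    QCSGD.integrable_and_integral_le_of_lintegral_le hVm hV0 (by positivity) hmoms
  refine ⟨π, hπ, hinv, huniq, fun θ₀ => ?_, hVi, hVle⟩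
  obtain ⟨M, hM⟩ := hconv θ₀
  refine ⟨ρ, M, hρ0, hρ1, fun T => ?_⟩
  have hnn : 0 ≤ M * ρ ^ T := (abs_nonneg _).trans (hM T ∅ MeasurableSet.empty)
  have : Nonempty {A : Set (QCSGD.E d) // MeasurableSet A} := ⟨⟨∅, MeasurableSet.empty⟩⟩
  refine ciSup_le fun A => ?_
  rw [QCSGD.lawAt_dirac_eq_pow]
  exact (hM T A A.2).trans (le_mul_of_one_le_right hnn (by nlinarith [sq_nonneg ‖θ₀ - θs‖]))
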